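/- For a square complex matrix $M$ let $W(M)=\{\langle Mx,x\rangle:\|x\|=1\}$ be its numerical range, and let $\operatorname{Im} M=(M-M^*)/(2i)$. Call a set in the plane bi-elliptical if it is the convex hull of two non-degenerate ellipses (circles are allowed) with distinct centers, neither of which is contained in the convex hull of the other. Let $\alpha\in\mathbb C$, let $C,D\in\mathbb C^{2\times 2}$, and let $A=\begin{bmatrix}\alpha I & C\\ D & -\alpha I\end{bmatrix}\in\mathbb C^{4\times 4}$. Then $W(A)$ is bi-elliptical if and only if there exists $\theta\in\mathbb R$ such that both of the following conditions hold. (i) $e^{-i\theta}C-e^{i\theta}D^*$ is a scalar multiple of a unitary matrix, while $(e^{-i\theta}C-e^{i\theta}D^*)D$ is not normal. (ii) The matrix $\operatorname{Im}\bigl((e^{-i\theta}A)^2\bigr)$ has exactly two distinct eigenvalues $s_1(\theta)\ne s_2(\theta)$, and the eigenvalues of $e^{-i\theta}A$, counted with multiplicity, can be written as $\pm\sigma_1(\theta),\pm\sigma_2(\theta)$ with the signs of $\sigma_1(\theta),\sigma_2(\theta)$ chosen so that $$4\sqrt{\det\bigl(\operatorname{Im}(e^{-i\theta}A)\bigr)}\,\bigl(\sigma_1(\theta)+\sigma_2(\theta)\bigr)^2=\bigl(s_1(\theta)-s_2(\theta)\bigr)^2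 .$$ -/

import Mathlib

open scoped ComplexStarModule

/-- The numerical range `W(A) = {⟨A x, x⟩ : ‖x‖ = 1}` of a complex square matrix, with the Euclidean
inner product and norm. (Mathlib's `inner ℂ x y` is linear in `y`.) -/
def numericalRange {n : Type*} [Fintype n] [DecidableEq n] (A : Matrix n n ℂ) : Set ℂ :=
  {z | ∃ x : EuclideanSpace ℂ n, ‖x‖ = 1 ∧ z = inner ℂ x (Matrix.toEuclideanLin A x)}

/-- The ellipse (a curve) in the complex plane with center `c` and semi-axes `a`, `b`, the axis
belonging to `a` having the direction `exp (i φ)`. It is non-degenerate when `0 < a` and `0 < b`. -/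
def ellipse (c : ℂ) (a b φ : ℝ) : Set ℂ :=
  {z | ∃ t : ℝ, z = c + Complex.exp (φ * Complex.I) *
    ((a * Real.cos t : ℝ) + (b * Real.sin t : ℝ) * Complex.I)}

/-- A planar set is bi-elliptical if it is the convex hull of two non-degenerate ellipses with
distinct centers, neither of which is contained in the convex hull of the other (so that the set is
not just one elliptical disk). -/
def IsBiElliptical (S : Set ℂ) : Prop :=
  ∃ (c₁ c₂ : ℂ) (a₁ b₁ φ₁ a₂ b₂ φ₂ : ℝ),
    0 < a₁ ∧ 0 < b₁ ∧ 0 < a₂ ∧ 0 < b₂ ∧ c₁ ≠ c₂ ∧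
    ¬ ellipse c₁ a₁ b₁ φ₁ ⊆ convexHull ℝ (ellipse c₂ a₂ b₂ φ₂) ∧
    ¬ ellipse c₂ a₂ b₂ φ₂ ⊆ convexHull ℝ (ellipse c₁ a₁ b₁ φ₁) ∧
    S = convexHull ℝ (ellipse c₁ a₁ b₁ φ₁ ∪ ellipse c₂ a₂ b₂ φ₂)

/-- The matrix `[[α I, C], [D, -α I]]` with 2-by-2 blocks. -/
def blockMatrix (α : ℂ) (C D : Matrix (Fin 2) (Fin 2) ℂ) :
    Matrix (Fin 2 ⊕ Fin 2) (Fin 2 ⊕ Fin 2) ℂ :=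
  Matrix.fromBlocks (α • (1 : Matrix (Fin 2) (Fin 2) ℂ)) C D
    ((-α) • (1 : Matrix (Fin 2) (Fin 2) ℂ))

/-- The rotated matrix `exp (-i θ) M`. -/
noncomputable def rot {n : Type*} (θ : ℝ) (M : Matrix n n ℂ) : Matrix n n ℂ :=
  Complex.exp (-(θ * Complex.I)) • M

/-- The imaginary part `(M - Mᴴ) / (2 i)` of a matrix. -/
noncomputable def imPart {n : Type*} [Fintype n] (M : Matrix n n ℂ) : Matrix n n ℂ :=
  (ℑ M : Matrix n n ℂ)

theorem imPart_eq {n : Type*} [Fintype n] (M : Matrix n n ℂ) :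
    imPart M = (2 * Complex.I)⁻¹ • (M - M.conjTranspose) := by
  ext i j
  simp [imPart, imaginaryPart_apply_coe, Matrix.star_eq_conjTranspose]
  ring

/-- `M` is a scalar multiple of a unitary matrix. -/
def IsScalarMultipleOfUnitary {n : Type*} [Fintype n] [DecidableEq n] (M : Matrix n n ℂ) : Prop :=
  ∃ (c : ℂ) (U : Matrix n n ℂ), U ∈ Matrix.unitaryGroup n ℂ ∧ M = c • U

/-- The matrix `exp (-i θ) C - exp (i θ) D*`. -/
noncomputable def offDiag (θ : ℝ) (C D : Matrix (Fin 2) (Fin 2) ℂ) : Matrix (Fin 2) (Fin 2) ℂ :=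
  Complex.exp (-(θ * Complex.I)) • C - Complex.exp (θ * Complex.I) • D.conjTranspose

/-- The equation `4 √det(Im(e^{-iθ}A)) (σ₁ + σ₂)² = (s₁ - s₂)²`, where `σ₁, -σ₁, σ₂, -σ₂` are the
eigenvalues of `e^{-iθ}A` counted with multiplicity (for some choice of the signs of `σ₁`, `σ₂`) and
`s₁ ≠ s₂` are the distinct eigenvalues of the Hermitian matrix `Im((e^{-iθ}A)²)`. The determinant of
the Hermitian matrix `Im(e^{-iθ}A)` is real; its real part is taken to form the real root. -/
def SpreadCondition {n : Type*} [Fintype n] [DecidableEq n] (θ : ℝ) (A : Matrix n n ℂ) : Prop :=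
  ∃ (σ₁ σ₂ : ℂ) (s₁ s₂ : ℝ),
    (rot θ A).charpoly.roots = {σ₁, -σ₁, σ₂, -σ₂} ∧
    s₁ ≠ s₂ ∧ spectrum ℂ (imPart (rot θ A ^ 2)) = {(s₁ : ℂ), (s₂ : ℂ)} ∧
    4 * (Real.sqrt (imPart (rot θ A)).det.re : ℂ) * (σ₁ + σ₂) ^ 2 = ((s₁ : ℂ) - (s₂ : ℂ)) ^ 2

/-!
The proof goes through the support function. The Hermitian matrix `Re (exp (-i φ) A)` is again a
block matrix of the same shape, with the real number `Re (exp (-i φ) α)` on the diagonal and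
off-diagonal blocks `K`, `Kᴴ`, so the squares of its eigenvalues are those of the Hermitian 2-by-2
matrix `Re (exp (-i φ) α) ^ 2 + K Kᴴ`. Hence the value of the support function of `W(A)` in the
direction `exp (i φ)` is a root of the biquadratic `(x ^ 2 - m φ) ^ 2 - d φ`, where `m` (`eigMean`)
and `d` (`eigDisc`) are trigonometric polynomials of period `π`
(`det_smul_one_sub_hermPart`, `det_eq_zero_of_isGreatest_dirCoord`).

*Geometry.* An ellipse with center `c` has support function `u + √w` with `u φ = Re (exp (-i φ) c)`
and `w` a positive definite quadratic form in `cos φ`, `sin φ`. If `W(A)` is bi-elliptical, an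
ellipse with center `c ≠ 0` determines the support function on an arc of directions, so `u + √w` is
a root of the biquadratic there, and by analyticity everywhere; so is `-u + √w`, by passing to the
opposite direction. Therefore `m = u ^ 2 + w` and `d = 4 u ^ 2 w`. Conversely these identities
make `|u| + √w` the support function of `W(A)`, and since `W(A)` is compact and convex (by the
Toeplitz–Hausdorff theorem, `convex_numericalRange`) it is the convex hull of the ellipse and its
mirror image. This is `isBiElliptical_numericalRange_iff`.

*Algebra.* After a rotation by `θ = arg c` the center is real and `u = |c| cos φ` vanishes at
`φ = π / 2`, which forces `K (π / 2)`, a multiple of `offDiag θ C D`, to be a multiple of a unitary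
matrix. Writing 2-by-2 Hermitian matrices in Pauli coordinates and comparing coefficients, the
identities become three equations for `γ = |c| ^ 2` and an inequality that expresses that `w` is
positive definite (`PauliCondition`, `exists_pauliCondition_iff`). The inequality says that two
traceless parts are linearly independent, which is the failure of normality
(`not_isStarNormal_iff`). The three equations are equivalent to the spread condition
(`spreadCondition_iff`): there `4 γ` is `(σ₁ + σ₂) ^ 2`, the number `√det (Im A)` is the coefficient
of `sin² φ` in `m`, and `s₁ - s₂` is read off from the traceless part of `Im (A ^ 2)`.
-/

/-! ### Support functions of plane sets -/

/-- The coordinate `Re (exp (-i φ) z)` of `z` in the direction `exp (i φ)`. -/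
noncomputable def dirCoord (φ : ℝ) (z : ℂ) : ℝ := Real.cos φ * z.re + Real.sin φ * z.im

theorem dirCoord_add (φ : ℝ) (z w : ℂ) : dirCoord φ (z + w) = dirCoord φ z + dirCoord φ w := by
  simp [dirCoord]; ring

theorem dirCoord_smul (φ r : ℝ) (z : ℂ) : dirCoord φ (r • z) = r * dirCoord φ z := by
  simp [dirCoord]; ring

theorem dirCoord_neg (φ : ℝ) (z : ℂ) : dirCoord φ (-z) = -dirCoord φ z := by
  simp [dirCoord]; ring

theorem dirCoord_add_pi (φ : ℝ) (z : ℂ) : dirCoord (φ + Real.pi) z = -dirCoord φ z := by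
  simp [dirCoord]; ring

theorem dirCoord_exp_mul (φ θ : ℝ) (z : ℂ) :
    dirCoord φ (Complex.exp (θ * Complex.I) * z) = dirCoord (φ - θ) z := by
  simp [dirCoord, Complex.exp_mul_I, ← Complex.ofReal_cos, ← Complex.ofReal_sin, Real.cos_sub,
    Real.sin_sub]
  ring

theorem dirCoord_eq_re (φ : ℝ) (z : ℂ) :
    dirCoord φ z = (Complex.exp (-(φ * Complex.I)) * z).re := by
  rw [← neg_mul, ← Complex.ofReal_neg, Complex.exp_mul_I, ← Complex.ofReal_cos,
    ← Complex.ofReal_sin]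
  simp [dirCoord, -Complex.ofReal_cos, -Complex.ofReal_sin]

theorem continuous_dirCoord (φ : ℝ) : Continuous (dirCoord φ) := by
  unfold dirCoord; fun_prop

theorem isLinearMap_dirCoord (φ : ℝ) : IsLinearMap ℝ (dirCoord φ) :=
  ⟨dirCoord_add φ, fun r z => dirCoord_smul φ r z⟩

theorem dirCoord_arg (z : ℂ) : dirCoord z.arg z = ‖z‖ := by
  rw [dirCoord_eq_re]
  have h := Complex.norm_mul_exp_arg_mul_I z
  have : Complex.exp (-(z.arg * Complex.I)) * z = (‖z‖ : ℂ) := by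
    conv_lhs => rw [← h]
    rw [mul_left_comm, ← Complex.exp_add]
    simp
  rw [this, Complex.ofReal_re]

/-- Strict separation of a point from a closed convex plane set, by a direction. -/
theorem exists_dirCoord_lt {S : Set ℂ} (hc : Convex ℝ S) (hcl : IsClosed S)
    {z : ℂ} (hz : z ∉ S) : ∃ φ : ℝ, ∀ y ∈ S, dirCoord φ y < dirCoord φ z := by
  obtain ⟨f, s, hs, hsz⟩ := geometric_hahn_banach_closed_point hc hcl hz
  set v : ℂ := ⟨f 1, f Complex.I⟩ with hv
  have hf : ∀ w : ℂ, f w = ‖v‖ * dirCoord v.arg w := by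
    intro w
    have h1 : f w = w.re * f 1 + w.im * f Complex.I := by
      have : w = w.re • (1 : ℂ) + w.im • Complex.I := by
        apply Complex.ext <;> simp
      conv_lhs => rw [this]
      rw [map_add, map_smul, map_smul, smul_eq_mul, smul_eq_mul]
    have h2 : ‖v‖ * Real.cos v.arg = f 1 := by rw [Complex.norm_mul_cos_arg]
    have h3 : ‖v‖ * Real.sin v.arg = f Complex.I := by rw [Complex.norm_mul_sin_arg]
    rw [h1, dirCoord, ← h2, ← h3]
    ring
  refine ⟨v.arg, fun y hy => ?_⟩
  have h := (hs y hy).trans hsz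
  rw [hf, hf] at h
  exact lt_of_mul_lt_mul_left h (norm_nonneg _)

theorem subset_of_dirCoord_le {S T : Set ℂ} (hc : Convex ℝ T)
    (hcl : IsClosed T) (h : ∀ φ : ℝ, ∀ y ∈ S, ∃ z ∈ T, dirCoord φ y ≤ dirCoord φ z) : S ⊆ T := by
  intro y hy
  by_contra hyT
  obtain ⟨φ, hφ⟩ := exists_dirCoord_lt hc hcl hyT
  obtain ⟨z, hz, hle⟩ := h φ y hy
  exact absurd (hφ z hz) (not_lt.2 hle)

theorem dirCoord_le_of_mem_convexHull {S : Set ℂ} {φ r : ℝ} (h : ∀ z ∈ S, dirCoord φ z ≤ r)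
    {z : ℂ} (hz : z ∈ convexHull ℝ S) : dirCoord φ z ≤ r :=
  convexHull_min (t := {z | dirCoord φ z ≤ r}) h
    (convex_halfSpace_le (isLinearMap_dirCoord φ) r) hz

/-! ### Ellipses -/

/-- The square of the half-width, in the direction `exp (i φ)`, of an ellipse with semi-axes `a`,
`b`, the axis belonging to `a` having the direction `exp (i ψ)`. -/
noncomputable def halfWidthSq (a b ψ φ : ℝ) : ℝ :=
  (a * Real.cos (φ - ψ)) ^ 2 + (b * Real.sin (φ - ψ)) ^ 2

theorem halfWidthSq_pos {a b : ℝ} (ha : 0 < a) (hb : 0 < b) (ψ φ : ℝ) :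
    0 < halfWidthSq a b ψ φ := by
  unfold halfWidthSq
  rcases eq_or_ne (Real.cos (φ - ψ)) 0 with h | h
  · have h1 : Real.sin (φ - ψ) ≠ 0 := by
      intro h2
      have := Real.sin_sq_add_cos_sq (φ - ψ)
      rw [h, h2] at this
      norm_num at this
    positivity
  · positivity

theorem halfWidthSq_add_pi (a b ψ φ : ℝ) :
    halfWidthSq a b ψ (φ + Real.pi) = halfWidthSq a b ψ φ := by
  simp [halfWidthSq, add_sub_right_comm]

/-- The support function of an ellipse. -/
noncomputable def ellipseSupport (c : ℂ) (a b ψ φ : ℝ) : ℝ :=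
  dirCoord φ c + Real.sqrt (halfWidthSq a b ψ φ)

theorem dirCoord_ellipse_point (c : ℂ) (a b ψ φ t : ℝ) :
    dirCoord φ (c + Complex.exp (ψ * Complex.I) *
      ((a * Real.cos t : ℝ) + (b * Real.sin t : ℝ) * Complex.I)) =
    dirCoord φ c + (a * Real.cos (φ - ψ) * Real.cos t + b * Real.sin (φ - ψ) * Real.sin t) := by
  rw [dirCoord_add, dirCoord_exp_mul]
  simp [dirCoord, -Complex.ofReal_cos, -Complex.ofReal_sin]
  ring

theorem dirCoord_le_ellipseSupport {c z : ℂ} {a b ψ : ℝ} (φ : ℝ) (hz : z ∈ ellipse c a b ψ) :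
    dirCoord φ z ≤ ellipseSupport c a b ψ φ := by
  obtain ⟨t, rfl⟩ := hz
  rw [dirCoord_ellipse_point, ellipseSupport]
  gcongr
  apply Real.le_sqrt_of_sq_le
  unfold halfWidthSq
  -- The Cauchy–Schwarz inequality, as Lagrange's identity.
  have h := Real.sin_sq_add_cos_sq t
  nlinarith [sq_nonneg (a * Real.cos (φ - ψ) * Real.sin t - b * Real.sin (φ - ψ) * Real.cos t)]

theorem exists_mem_ellipse_dirCoord_eq (c : ℂ) (a b ψ φ : ℝ) :
    ∃ z ∈ ellipse c a b ψ, dirCoord φ z = ellipseSupport c a b ψ φ := by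
  set v : ℂ := ⟨a * Real.cos (φ - ψ), b * Real.sin (φ - ψ)⟩ with hv
  refine ⟨_, ⟨v.arg, rfl⟩, ?_⟩
  rw [dirCoord_ellipse_point, ellipseSupport]
  congr 1
  have h := dirCoord_arg v
  have h2 : ‖v‖ = Real.sqrt (halfWidthSq a b ψ φ) := by
    rw [Complex.norm_eq_sqrt_sq_add_sq]; rfl
  rw [← h2, ← h, dirCoord, hv]
  ring

theorem ellipse_nonempty (c : ℂ) (a b ψ : ℝ) : (ellipse c a b ψ).Nonempty := ⟨_, 0, rfl⟩

/-- The elliptical disk is the image of the closed unit disk under a real-affine map. -/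
theorem isCompact_convexHull_ellipse (c : ℂ) (a b ψ : ℝ) :
    IsCompact (convexHull ℝ (ellipse c a b ψ)) := by
  set g : ℂ →ₗ[ℝ] ℂ := (LinearMap.mulLeft ℝ (Complex.exp (ψ * Complex.I))).comp
    (Complex.equivRealProdLm.symm.toLinearMap.comp
      ((LinearMap.prodMap (a • LinearMap.id) (b • LinearMap.id)).comp
        Complex.equivRealProdLm.toLinearMap)) with hg
  have hg' : ∀ z : ℂ, g z =
      Complex.exp (ψ * Complex.I) * ((a * z.re : ℝ) + (b * z.im : ℝ) * Complex.I) := by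
    intro z
    simp only [hg, LinearMap.comp_apply, LinearMap.mulLeft_apply]
    congr 1
    apply Complex.ext <;> simp [Complex.equivRealProdLm]
  set f : ℂ →ᵃ[ℝ] ℂ := g.toAffineMap + AffineMap.const ℝ ℂ c with hf
  have hf' : ∀ z : ℂ, f z = g z + c := fun z => rfl
  have him : ellipse c a b ψ = f '' Metric.sphere 0 1 := by
    ext z
    constructor
    · rintro ⟨t, rfl⟩
      refine ⟨Complex.exp (t * Complex.I), by simp [Complex.norm_exp_ofReal_mul_I], ?_⟩
      rw [hf', hg', add_comm, Complex.exp_ofReal_mul_I_re, Complex.exp_ofReal_mul_I_im]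
    · rintro ⟨w, hw, rfl⟩
      have hw : ‖w‖ = 1 := by simpa using hw
      refine ⟨w.arg, ?_⟩
      have h1 := Complex.norm_mul_cos_arg w
      have h2 := Complex.norm_mul_sin_arg w
      rw [hw, one_mul] at h1 h2
      rw [hf', hg', h1, h2, add_comm]
  rw [him, ← AffineMap.image_convexHull, convexHull_sphere_eq_closedBall _ zero_le_one]
  apply (isCompact_closedBall _ _).image
  exact f.continuous_of_finiteDimensional

theorem IsCompact.convexJoin {S T : Set ℂ} (hS : IsCompact S) (hT : IsCompact T) :
    IsCompact (convexJoin ℝ S T) := by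
  have h : _root_.convexJoin ℝ S T =
      (fun p : (ℂ × ℂ) × ℝ => (1 - p.2) • p.1.1 + p.2 • p.1.2) ''
        ((S ×ˢ T) ×ˢ Set.Icc (0 : ℝ) 1) := by
    ext z
    simp only [mem_convexJoin, segment_eq_image, Set.mem_image, Set.mem_prod, Prod.exists]
    constructor
    · rintro ⟨a, ha, b, hb, t, ht, rfl⟩
      exact ⟨a, b, t, ⟨⟨ha, hb⟩, ht⟩, rfl⟩
    · rintro ⟨a, b, t, ⟨⟨ha, hb⟩, ht⟩, rfl⟩
      exact ⟨a, ha, b, hb, t, ht, rfl⟩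
  rw [h]
  exact ((hS.prod hT).prod isCompact_Icc).image (by fun_prop)

theorem isCompact_convexHull_ellipse_union (c₁ c₂ : ℂ) (a₁ b₁ ψ₁ a₂ b₂ ψ₂ : ℝ) :
    IsCompact (convexHull ℝ (ellipse c₁ a₁ b₁ ψ₁ ∪ ellipse c₂ a₂ b₂ ψ₂)) := by
  rw [convexHull_union (ellipse_nonempty ..) (ellipse_nonempty ..)]
  exact (isCompact_convexHull_ellipse ..).convexJoin (isCompact_convexHull_ellipse ..)

/-- An ellipse that is not contained in the elliptical disk of another one is strictly wider in
some direction. -/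
theorem exists_ellipseSupport_lt {c₁ c₂ : ℂ} {a₁ b₁ ψ₁ a₂ b₂ ψ₂ : ℝ}
    (h : ¬ ellipse c₁ a₁ b₁ ψ₁ ⊆ convexHull ℝ (ellipse c₂ a₂ b₂ ψ₂)) :
    ∃ φ, ellipseSupport c₂ a₂ b₂ ψ₂ φ < ellipseSupport c₁ a₁ b₁ ψ₁ φ := by
  by_contra! hle
  refine h (subset_of_dirCoord_le (convex_convexHull ℝ _)
    (isCompact_convexHull_ellipse ..).isClosed fun φ y hy => ?_)
  obtain ⟨z, hz, hzφ⟩ := exists_mem_ellipse_dirCoord_eq c₂ a₂ b₂ ψ₂ φ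
  exact ⟨z, subset_convexHull ℝ _ hz,
    ((dirCoord_le_ellipseSupport φ hy).trans (hle φ)).trans_eq hzφ.symm⟩

/-- In the direction of `c`, an ellipse with center `c` reaches farther than its mirror image. -/
theorem not_ellipse_subset_convexHull_neg {c : ℂ} (hc : c ≠ 0) (a b ψ : ℝ) :
    ¬ ellipse c a b ψ ⊆ convexHull ℝ (ellipse (-c) a b ψ) := by
  intro h
  obtain ⟨z, hz, hzφ⟩ := exists_mem_ellipse_dirCoord_eq c a b ψ c.arg
  have h1 := dirCoord_le_of_mem_convexHull
    (fun w hw => dirCoord_le_ellipseSupport c.arg hw) (h hz)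
  rw [hzφ, ellipseSupport, ellipseSupport, dirCoord_neg, dirCoord_arg] at h1
  have : 0 < ‖c‖ := norm_pos_iff.2 hc
  linarith

/-! ### The numerical range -/

section ToeplitzHausdorff

variable {E : Type*} [NormedAddCommGroup E] [InnerProductSpace ℂ E]

/-- The case of the Toeplitz–Hausdorff theorem in which the two given values are `0` and `1`:
after multiplying `y` by a unimodular number, the form is real on the real segment from `x` to `y`,
and the intermediate value theorem applies. -/
theorem exists_inner_eq_of_zero_one (T : E →ₗ[ℂ] E) {x y : E} (hx : ‖x‖ = 1)
    (hx0 : inner ℂ x (T x) = 0) (hy1 : inner ℂ y (T y) = 1) {t : ℝ} (ht : t ∈ Set.Icc (0 : ℝ) 1)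
    (hy : ‖y‖ = 1) : ∃ z : E, ‖z‖ = 1 ∧ inner ℂ z (T z) = (t : ℂ) := by
  set δ : ℂ := inner ℂ x (T y) - (starRingEnd ℂ) (inner ℂ y (T x)) with hδ
  -- The unimodular `η` makes `κ`, the sum of the cross terms for `x` and `η • y`, a real number.
  set η : ℂ := Complex.exp ((-δ.arg : ℝ) * Complex.I) with hη
  have hηn : ‖η‖ = 1 := Complex.norm_exp_ofReal_mul_I _
  have hηη : (starRingEnd ℂ) η * η = 1 := by
    rw [mul_comm, Complex.mul_conj, Complex.normSq_eq_norm_sq, hηn]; norm_num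
  have hηδ : η * δ = (‖δ‖ : ℂ) := by
    conv_lhs => rw [← Complex.norm_mul_exp_arg_mul_I δ]
    rw [hη, mul_left_comm, ← Complex.exp_add]
    simp
  set κ : ℂ := η * inner ℂ x (T y) + (starRingEnd ℂ) η * inner ℂ y (T x) with hκ
  have hκr : κ = (κ.re : ℂ) := by
    apply Complex.ext
    · simp
    · have h1 : κ = η * δ + (η * (starRingEnd ℂ) (inner ℂ y (T x)) +
          (starRingEnd ℂ) η * inner ℂ y (T x)) := by rw [hκ, hδ]; ring
      rw [h1, hηδ]
      generalize inner ℂ y (T x) = v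
      simp
      ring
  set z : ℝ → E := fun s => ((1 - s : ℝ) : ℂ) • x + ((s : ℝ) : ℂ) • (η • y) with hz
  have hzT : ∀ s : ℝ, inner ℂ (z s) (T (z s)) = ((s ^ 2 + s * (1 - s) * κ.re : ℝ) : ℂ) := by
    intro s
    have h1 : inner ℂ (z s) (T (z s)) =
        (1 - s) ^ 2 * inner ℂ x (T x) + s * (1 - s) * κ +
          s ^ 2 * ((starRingEnd ℂ) η * η) * inner ℂ y (T y) := by
      simp only [hz, hκ, map_add, map_smul, inner_add_left, inner_add_right, inner_smul_left,
        inner_smul_right, Complex.conj_ofReal]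
      push_cast
      ring
    rw [h1, hx0, hy1, hηη, hκr]
    push_cast [Complex.ofReal_re]
    ring
  have hz0 : ∀ s : ℝ, z s ≠ 0 := by
    intro s h0
    have hs : ((1 - s : ℝ) : ℂ) • x = -((s : ℂ) • (η • y)) := eq_neg_of_add_eq_zero_left h0
    have h1 : inner ℂ (((1 - s : ℝ) : ℂ) • x) (T (((1 - s : ℝ) : ℂ) • x)) = 0 := by
      rw [map_smul, inner_smul_left, inner_smul_right, hx0, mul_zero, mul_zero]
    rw [hs] at h1
    simp only [map_neg, map_smul, inner_neg_left, inner_neg_right, inner_smul_left,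
      inner_smul_right, Complex.conj_ofReal, hy1] at h1
    have hη0 : η ≠ 0 := by rw [← norm_ne_zero_iff, hηn]; exact one_ne_zero
    have hs0 : s = 0 := by simpa [hη0] using h1
    rw [hs0] at hs
    have : x = 0 := by simpa using hs
    rw [this, norm_zero] at hx
    exact zero_ne_one hx
  have hzc : Continuous z := by fun_prop
  have hcont : ContinuousOn (fun s : ℝ => (s ^ 2 + s * (1 - s) * κ.re) / ‖z s‖ ^ 2)
      (Set.Icc 0 1) := by
    apply Continuous.continuousOn
    refine Continuous.div (by fun_prop) (by fun_prop) fun s => ?_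
    exact pow_ne_zero _ (norm_ne_zero_iff.2 (hz0 s))
  have hz1n : ‖z 1‖ = 1 := by simp [hz, norm_smul, hηn, hy]
  have hivt := intermediate_value_Icc zero_le_one hcont
  simp only [hz1n] at hivt
  obtain ⟨s, -, hs⟩ := hivt (by simpa using ht)
  have hn : ‖z s‖ ≠ 0 := norm_ne_zero_iff.2 (hz0 s)
  refine ⟨((‖z s‖⁻¹ : ℝ) : ℂ) • z s, ?_, ?_⟩
  · rw [norm_smul, Complex.norm_real, norm_inv, norm_norm, inv_mul_cancel₀ hn]
  · rw [map_smul, inner_smul_left, inner_smul_right, hzT, Complex.conj_ofReal, ← hs]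
    push_cast
    field_simp

end ToeplitzHausdorff

/-- The Hermitian matrix `Re (exp (-i φ) A)`. -/
noncomputable def hermPart {n : Type*} (φ : ℝ) (A : Matrix n n ℂ) : Matrix n n ℂ :=
  (2⁻¹ : ℂ) • (Complex.exp (-(φ * Complex.I)) • A + Complex.exp (φ * Complex.I) • A.conjTranspose)

theorem isHermitian_hermPart {n : Type*} (φ : ℝ) (A : Matrix n n ℂ) :
    (hermPart φ A).IsHermitian := by
  rw [Matrix.IsHermitian, hermPart, Matrix.conjTranspose_smul, Matrix.conjTranspose_add,
    Matrix.conjTranspose_smul, Matrix.conjTranspose_smul, Matrix.conjTranspose_conjTranspose,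
    add_comm]
  simp [← Complex.exp_conj]

theorem imPart_eq_hermPart {n : Type*} [Fintype n] (A : Matrix n n ℂ) :
    imPart A = hermPart (Real.pi / 2) A := by
  have h1 : Complex.exp (((Real.pi / 2 : ℝ) : ℂ) * Complex.I) = Complex.I := by
    push_cast; exact Complex.exp_pi_div_two_mul_I
  rw [imPart_eq, hermPart, Complex.exp_neg, h1, mul_inv, mul_smul, Complex.inv_I, neg_smul,
    neg_smul, smul_sub]
  congr 1
  abel

section NumericalRange

variable {n : Type*} [Fintype n] [DecidableEq n]

/-- The **Toeplitz–Hausdorff theorem**. -/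
theorem convex_numericalRange (A : Matrix n n ℂ) : Convex ℝ (numericalRange A) := by
  rw [convex_iff_segment_subset]
  rintro _ ⟨x, hx, rfl⟩ _ ⟨y, hy, rfl⟩ w hw
  set T := Matrix.toEuclideanLin A
  set a := inner ℂ x (T x) with ha
  set b := inner ℂ y (T y) with hb
  rw [segment_eq_image'] at hw
  obtain ⟨t, ht, rfl⟩ := hw
  rcases eq_or_ne a b with hab | hab
  · exact ⟨x, hx, by simp [← hab, ha, T]⟩
  have hba : b - a ≠ 0 := sub_ne_zero.2 hab.symm
  set S : EuclideanSpace ℂ n →ₗ[ℂ] EuclideanSpace ℂ n := (b - a)⁻¹ • (T - a • LinearMap.id) with hS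
  have hSz : ∀ z : EuclideanSpace ℂ n, ‖z‖ = 1 →
      inner ℂ z (S z) = (b - a)⁻¹ * (inner ℂ z (T z) - a) := by
    intro z hz
    simp [hS, inner_self_eq_norm_sq_to_K, hz]
  obtain ⟨z, hz, hzt⟩ := exists_inner_eq_of_zero_one S hx (by rw [hSz x hx, ← ha]; simp)
    (by rw [hSz y hy, ← hb]; field_simp) ht hy
  refine ⟨z, hz, ?_⟩
  rw [hSz z hz] at hzt
  change a + (t : ℝ) • (b - a) = inner ℂ z (T z)
  rw [Complex.real_smul, ← hzt]
  field_simp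
  ring

theorem numericalRange_eq_image (A : Matrix n n ℂ) : numericalRange A =
    (fun x : EuclideanSpace ℂ n => inner ℂ x (Matrix.toEuclideanLin A x)) ''
      Metric.sphere 0 1 := by
  ext z
  simp [numericalRange, eq_comm]

theorem isCompact_numericalRange (A : Matrix n n ℂ) : IsCompact (numericalRange A) := by
  rw [numericalRange_eq_image]
  have h : Continuous (Matrix.toEuclideanLin A) := LinearMap.continuous_of_finiteDimensional _
  exact (isCompact_sphere _ _).image (by fun_prop)

theorem dirCoord_inner (φ : ℝ) (A : Matrix n n ℂ) (x : EuclideanSpace ℂ n) :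
    ((dirCoord φ (inner ℂ x (Matrix.toEuclideanLin A x)) : ℝ) : ℂ) =
      inner ℂ x (Matrix.toEuclideanLin (hermPart φ A) x) := by
  have hstar : inner ℂ x (Matrix.toEuclideanLin A.conjTranspose x) =
      (starRingEnd ℂ) (inner ℂ x (Matrix.toEuclideanLin A x)) := by
    rw [Matrix.toEuclideanLin_conjTranspose_eq_adjoint, LinearMap.adjoint_inner_right,
      inner_conj_symm]
  have hexp : Complex.exp (φ * Complex.I) =
      (starRingEnd ℂ) (Complex.exp (-(φ * Complex.I))) := by
    rw [← Complex.exp_conj]; simp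
  rw [hermPart, map_smul, map_add, map_smul, map_smul, LinearMap.smul_apply, LinearMap.add_apply,
    LinearMap.smul_apply, LinearMap.smul_apply, inner_smul_right, inner_add_right,
    inner_smul_right, inner_smul_right, hstar, hexp, ← map_mul, Complex.add_conj,
    dirCoord_eq_re]
  push_cast
  ring

theorem exists_mulVec_eq_smul {A : Matrix n n ℂ} {y : ℝ}
    (h : (((y : ℝ) : ℂ) • (1 : Matrix n n ℂ) - A).det = 0) :
    ∃ x : EuclideanSpace ℂ n, ‖x‖ = 1 ∧ Matrix.toEuclideanLin A x = (y : ℂ) • x := by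
  obtain ⟨v, hv0, hv⟩ := Matrix.exists_mulVec_eq_zero_iff.2 h
  have hvA : A.mulVec v = (y : ℂ) • v := by
    rw [Matrix.sub_mulVec, Matrix.smul_mulVec, Matrix.one_mulVec, sub_eq_zero] at hv
    exact hv.symm
  set x : EuclideanSpace ℂ n := WithLp.toLp 2 v with hx
  have hx0 : x ≠ 0 := fun h0 => hv0 (by simpa [hx] using h0)
  have hn : ‖x‖ ≠ 0 := norm_ne_zero_iff.2 hx0
  have hAx : Matrix.toEuclideanLin A x = (y : ℂ) • x := by
    rw [hx, Matrix.toLpLin_toLp, Matrix.toLin'_apply, hvA]; rfl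
  refine ⟨((‖x‖⁻¹ : ℝ) : ℂ) • x, ?_, ?_⟩
  · rw [norm_smul, Complex.norm_real, norm_inv, norm_norm, inv_mul_cancel₀ hn]
  · rw [map_smul, hAx, smul_comm]

theorem exists_dirCoord_eq_of_det_eq_zero {A : Matrix n n ℂ} {φ y : ℝ}
    (h : (((y : ℝ) : ℂ) • (1 : Matrix n n ℂ) - hermPart φ A).det = 0) :
    ∃ z ∈ numericalRange A, dirCoord φ z = y := by
  obtain ⟨x, hx, hxA⟩ := exists_mulVec_eq_smul h
  refine ⟨_, ⟨x, hx, rfl⟩, ?_⟩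
  apply Complex.ofReal_injective
  rw [dirCoord_inner, hxA, inner_smul_right, inner_self_eq_norm_sq_to_K, hx]
  simp

/-- The value of the support function of the numerical range in the direction `exp (i φ)` is an
eigenvalue of `Re (exp (-i φ) A)`, since a maximizer of the Rayleigh quotient is an eigenvector. -/
theorem det_eq_zero_of_isGreatest_dirCoord {A : Matrix n n ℂ} {φ y : ℝ}
    (hle : ∀ z ∈ numericalRange A, dirCoord φ z ≤ y)
    (hmem : ∃ z ∈ numericalRange A, dirCoord φ z = y) :
    (((y : ℝ) : ℂ) • (1 : Matrix n n ℂ) - hermPart φ A).det = 0 := by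
  obtain ⟨_, ⟨x, hx, rfl⟩, hxy⟩ := hmem
  set T : EuclideanSpace ℂ n →L[ℂ] EuclideanSpace ℂ n :=
    LinearMap.toContinuousLinearMap (Matrix.toEuclideanLin (hermPart φ A)) with hT
  have hTx : ∀ x, T x = Matrix.toEuclideanLin (hermPart φ A) x := fun x => rfl
  have hsa : IsSelfAdjoint T := by
    rw [ContinuousLinearMap.isSelfAdjoint_iff_isSymmetric]
    exact Matrix.isSymmetric_toEuclideanLin_iff.2 (isHermitian_hermPart φ A)
  have hre : ∀ x : EuclideanSpace ℂ n,
      T.reApplyInnerSelf x = dirCoord φ (inner ℂ x (Matrix.toEuclideanLin A x)) := by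
    intro x
    rw [ContinuousLinearMap.reApplyInnerSelf_apply, inner_re_symm, hTx, ← dirCoord_inner]
    exact Complex.ofReal_re _
  have hmax : IsMaxOn T.reApplyInnerSelf (Metric.sphere 0 ‖x‖) x := by
    intro w hw
    rw [hx, mem_sphere_zero_iff_norm] at hw
    change T.reApplyInnerSelf w ≤ T.reApplyInnerSelf x
    rw [hre, hre, hxy]
    exact hle _ ⟨w, hw, rfl⟩
  have heig := hsa.eq_smul_self_of_isLocalExtrOn (Or.inr hmax.localize)
  have hray : T.rayleighQuotient x = y := by
    rw [ContinuousLinearMap.rayleighQuotient, hre, hxy, hx]; simp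
  rw [hray, hTx] at heig
  rw [← Matrix.exists_mulVec_eq_zero_iff]
  refine ⟨WithLp.ofLp x, ?_, ?_⟩
  · intro h0
    have : x = 0 := by ext i; exact congrFun h0 i
    rw [this, norm_zero] at hx
    exact zero_ne_one hx
  · have h1 : (hermPart φ A).mulVec (WithLp.ofLp x) = (y : ℂ) • WithLp.ofLp x :=
      congrArg WithLp.ofLp heig
    rw [Matrix.sub_mulVec, h1, Matrix.smul_mulVec, Matrix.one_mulVec]
    simp

end NumericalRange

/-! ### Hermitian 2-by-2 matrices -/

/-- Half the trace of a Hermitian 2-by-2 matrix, that is, its coefficient at the identity in the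
Pauli basis. (Real parts make it a real number for every matrix.) -/
noncomputable def halfTrace (S : Matrix (Fin 2) (Fin 2) ℂ) : ℝ := ((S 0 0).re + (S 1 1).re) / 2

/-- The Euclidean inner product of the traceless parts of two Hermitian 2-by-2 matrices, viewed as
vectors in `ℝ³` by means of the Pauli basis. -/
noncomputable def pauliDot (S T : Matrix (Fin 2) (Fin 2) ℂ) : ℝ :=
  ((S 0 0).re - (S 1 1).re) / 2 * (((T 0 0).re - (T 1 1).re) / 2) +
    (S 0 1).re * (T 0 1).re + (S 0 1).im * (T 0 1).im

/-- The characteristic polynomial of `S + i T` for Hermitian `S`, `T`, in Pauli coordinates. -/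
theorem det_smul_one_sub_add_I_smul {S T : Matrix (Fin 2) (Fin 2) ℂ} (hS : S.IsHermitian)
    (hT : T.IsHermitian) (z : ℂ) :
    (z • (1 : Matrix (Fin 2) (Fin 2) ℂ) - (S + Complex.I • T)).det =
      (z - (halfTrace S + Complex.I * halfTrace T)) ^ 2 -
        (pauliDot S S - pauliDot T T + 2 * Complex.I * pauliDot S T) := by
  have key : ∀ {R : Matrix (Fin 2) (Fin 2) ℂ}, R.IsHermitian →
      ∃ t x p q : ℝ, R 0 0 = t + x ∧ R 1 1 = t - x ∧ R 0 1 = p + q * Complex.I ∧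
        R 1 0 = p - q * Complex.I := by
    intro R hR
    have h00 := hR.apply 0 0
    have h11 := hR.apply 1 1
    have h10 := hR.apply 1 0
    refine ⟨((R 0 0).re + (R 1 1).re) / 2, ((R 0 0).re - (R 1 1).re) / 2, (R 0 1).re,
      (R 0 1).im, ?_, ?_, ?_, ?_⟩
    · rw [← Complex.conj_eq_iff_re.1 h00]; push_cast [Complex.ofReal_re]; ring
    · rw [← Complex.conj_eq_iff_re.1 h11]; push_cast [Complex.ofReal_re]; ring
    · exact (Complex.re_add_im _).symm
    · rw [← h10]
      apply Complex.ext <;> simp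
  obtain ⟨t, x, p, q, h1, h2, h3, h4⟩ := key hS
  obtain ⟨t', x', p', q', h1', h2', h3', h4'⟩ := key hT
  simp only [Matrix.det_fin_two, Matrix.sub_apply, Matrix.add_apply, Matrix.smul_apply,
    Matrix.one_apply, halfTrace, pauliDot, h1, h2, h3, h4, h1', h2', h3', h4', smul_eq_mul]
  simp
  ring_nf
  simp only [Complex.I_sq, show Complex.I ^ 3 = -Complex.I from by
    rw [pow_succ, Complex.I_sq]; ring, show Complex.I ^ 4 = 1 from Complex.I_pow_four]
  ring

theorem det_smul_one_sub_of_isHermitian {S : Matrix (Fin 2) (Fin 2) ℂ} (hS : S.IsHermitian)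
    (z : ℂ) : (z • (1 : Matrix (Fin 2) (Fin 2) ℂ) - S).det =
      (z - halfTrace S) ^ 2 - pauliDot S S := by
  have h := det_smul_one_sub_add_I_smul hS (Matrix.isHermitian_zero (n := Fin 2) (α := ℂ)) z
  simpa [halfTrace, pauliDot] using h

/-! ### Block matrices -/

theorem det_smul_one_sub_blockMatrix (z α : ℂ) (C D : Matrix (Fin 2) (Fin 2) ℂ) :
    (z • (1 : Matrix (Fin 2 ⊕ Fin 2) (Fin 2 ⊕ Fin 2) ℂ) - blockMatrix α C D).det =
      ((z ^ 2 - α ^ 2) • (1 : Matrix (Fin 2) (Fin 2) ℂ) - C * D).det := by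
  rw [← Matrix.det_submatrix_equiv_self finSumFinEquiv.symm]
  simp [blockMatrix, Matrix.det_succ_row_zero, Fin.sum_univ_succ,
    Matrix.mul_apply, finSumFinEquiv, Fin.addCases, Matrix.one_apply, Fin.succAbove]
  ring

theorem rot_blockMatrix (θ : ℝ) (α : ℂ) (C D : Matrix (Fin 2) (Fin 2) ℂ) :
    rot θ (blockMatrix α C D) =
      blockMatrix (Complex.exp (-(θ * Complex.I)) * α) (rot θ C) (rot θ D) := by
  simp [rot, blockMatrix, Matrix.fromBlocks_smul, smul_smul]

/-- The upper right block of `Re (exp (-i φ) A)` for `A = blockMatrix α C D`. -/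
noncomputable def offHerm (φ : ℝ) (C D : Matrix (Fin 2) (Fin 2) ℂ) : Matrix (Fin 2) (Fin 2) ℂ :=
  (2⁻¹ : ℂ) • (Complex.exp (-(φ * Complex.I)) • C +
    Complex.exp (φ * Complex.I) • D.conjTranspose)

theorem conjTranspose_offHerm (φ : ℝ) (C D : Matrix (Fin 2) (Fin 2) ℂ) :
    (offHerm φ C D).conjTranspose = offHerm φ D C := by
  rw [offHerm, offHerm, Matrix.conjTranspose_smul, Matrix.conjTranspose_add,
    Matrix.conjTranspose_smul, Matrix.conjTranspose_smul, Matrix.conjTranspose_conjTranspose,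
    add_comm]
  simp [← Complex.exp_conj]

theorem hermPart_blockMatrix (φ : ℝ) (α : ℂ) (C D : Matrix (Fin 2) (Fin 2) ℂ) :
    hermPart φ (blockMatrix α C D) =
      blockMatrix (dirCoord φ α) (offHerm φ C D) (offHerm φ C D).conjTranspose := by
  have h : (dirCoord φ α : ℂ) = (2⁻¹ : ℂ) * (Complex.exp (-(φ * Complex.I)) * α +
      Complex.exp (φ * Complex.I) * (starRingEnd ℂ) α) := by
    have hexp : Complex.exp (φ * Complex.I) =
        (starRingEnd ℂ) (Complex.exp (-(φ * Complex.I))) := by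
      rw [← Complex.exp_conj]; simp
    rw [hexp, ← map_mul, Complex.add_conj, dirCoord_eq_re]
    push_cast
    ring
  rw [conjTranspose_offHerm, hermPart, blockMatrix, blockMatrix, Matrix.fromBlocks_conjTranspose,
    Matrix.fromBlocks_smul, Matrix.fromBlocks_smul, Matrix.fromBlocks_add, Matrix.fromBlocks_smul,
    offHerm, offHerm, h]
  congr 1
  · ext i j
    rcases eq_or_ne i j with rfl | hij
    · simp
    · simp [hij]
  · ext i j
    rcases eq_or_ne i j with rfl | hij
    · simp; ring
    · simp [hij]

theorem offHerm_eq (φ : ℝ) (C D : Matrix (Fin 2) (Fin 2) ℂ) :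
    offHerm φ C D = (Real.cos φ : ℂ) • offHerm 0 C D +
      (Real.sin φ : ℂ) • offHerm (Real.pi / 2) C D := by
  have h1 : Complex.exp (((Real.pi / 2 : ℝ) : ℂ) * Complex.I) = Complex.I := by
    push_cast; exact Complex.exp_pi_div_two_mul_I
  simp only [offHerm, Complex.exp_neg, h1, Complex.inv_I]
  rw [← Complex.exp_neg, ← neg_mul, ← Complex.ofReal_neg, Complex.exp_mul_I, Complex.exp_mul_I,
    ← Complex.ofReal_cos, ← Complex.ofReal_sin, ← Complex.ofReal_cos, ← Complex.ofReal_sin,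
    Real.cos_neg, Real.sin_neg]
  ext i j
  simp [-Complex.ofReal_cos, -Complex.ofReal_sin]
  ring

theorem offHerm_rot (φ θ : ℝ) (C D : Matrix (Fin 2) (Fin 2) ℂ) :
    offHerm φ (rot θ C) (rot θ D) = offHerm (φ + θ) C D := by
  have h : (starRingEnd ℂ) (Complex.exp (-(θ * Complex.I))) = Complex.exp (θ * Complex.I) := by
    rw [← Complex.exp_conj]; simp
  simp only [offHerm, rot, Matrix.conjTranspose_smul, smul_smul, ← Complex.exp_add,
    Complex.star_def, h]
  congr 4 <;> push_cast <;> ring_nf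

/-- Half the sum of the squares of the two nonnegative eigenvalues of `Re (exp (-i φ) A)` for
`A = blockMatrix α C D`. -/
noncomputable def eigMean (α : ℂ) (C D : Matrix (Fin 2) (Fin 2) ℂ) (φ : ℝ) : ℝ :=
  dirCoord φ α ^ 2 + halfTrace (offHerm φ C D * (offHerm φ C D).conjTranspose)

/-- The square of half the difference of the squares of the two nonnegative eigenvalues of
`Re (exp (-i φ) A)` for `A = blockMatrix α C D`. -/
noncomputable def eigDisc (C D : Matrix (Fin 2) (Fin 2) ℂ) (φ : ℝ) : ℝ :=
  pauliDot (offHerm φ C D * (offHerm φ C D).conjTranspose)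
    (offHerm φ C D * (offHerm φ C D).conjTranspose)

theorem det_smul_one_sub_hermPart (φ x : ℝ) (α : ℂ) (C D : Matrix (Fin 2) (Fin 2) ℂ) :
    (((x : ℝ) : ℂ) • (1 : Matrix (Fin 2 ⊕ Fin 2) (Fin 2 ⊕ Fin 2) ℂ) -
      hermPart φ (blockMatrix α C D)).det =
        (((x ^ 2 - eigMean α C D φ) ^ 2 - eigDisc C D φ : ℝ) : ℂ) := by
  rw [hermPart_blockMatrix, det_smul_one_sub_blockMatrix,
    det_smul_one_sub_of_isHermitian (Matrix.isHermitian_mul_conjTranspose_self _), eigMean,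
    eigDisc]
  push_cast
  ring

/-- The symmetrized product `(L Mᴴ + M Lᴴ) / 2`. -/
noncomputable def symProd (L M : Matrix (Fin 2) (Fin 2) ℂ) : Matrix (Fin 2) (Fin 2) ℂ :=
  (2⁻¹ : ℂ) • (L * M.conjTranspose + M * L.conjTranspose)

theorem isHermitian_symProd (L M : Matrix (Fin 2) (Fin 2) ℂ) : (symProd L M).IsHermitian := by
  rw [Matrix.IsHermitian, symProd, Matrix.conjTranspose_smul, Matrix.conjTranspose_add,
    Matrix.conjTranspose_mul, Matrix.conjTranspose_mul, Matrix.conjTranspose_conjTranspose,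
    Matrix.conjTranspose_conjTranspose, add_comm]
  simp

theorem gram_eq (c s : ℝ) (L M : Matrix (Fin 2) (Fin 2) ℂ) :
    ((c : ℂ) • L + (s : ℂ) • M) * ((c : ℂ) • L + (s : ℂ) • M).conjTranspose =
      ((c ^ 2 : ℝ) : ℂ) • (L * L.conjTranspose) + ((2 * c * s : ℝ) : ℂ) • symProd L M +
        ((s ^ 2 : ℝ) : ℂ) • (M * M.conjTranspose) := by
  rw [symProd, Matrix.conjTranspose_add, Matrix.conjTranspose_smul, Matrix.conjTranspose_smul,
    Complex.star_def, Complex.conj_ofReal, Complex.conj_ofReal, smul_smul]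
  simp only [add_mul, mul_add, Matrix.smul_mul, Matrix.mul_smul, smul_smul]
  push_cast
  module

theorem halfTrace_combo (x y z : ℝ) (S T U : Matrix (Fin 2) (Fin 2) ℂ) :
    halfTrace ((x : ℂ) • S + (y : ℂ) • T + (z : ℂ) • U) =
      x * halfTrace S + y * halfTrace T + z * halfTrace U := by
  simp [halfTrace]; ring

theorem pauliDot_combo (x y z : ℝ) (S T U : Matrix (Fin 2) (Fin 2) ℂ) :
    pauliDot ((x : ℂ) • S + (y : ℂ) • T + (z : ℂ) • U)
        ((x : ℂ) • S + (y : ℂ) • T + (z : ℂ) • U) =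
      x ^ 2 * pauliDot S S + y ^ 2 * pauliDot T T + z ^ 2 * pauliDot U U +
        2 * x * y * pauliDot S T + 2 * x * z * pauliDot S U + 2 * y * z * pauliDot T U := by
  simp [pauliDot]; ring

theorem eigMean_eq (α : ℂ) (C D : Matrix (Fin 2) (Fin 2) ℂ) (φ : ℝ) :
    eigMean α C D φ =
      Real.cos φ ^ 2 * (α.re ^ 2 +
        halfTrace (offHerm 0 C D * (offHerm 0 C D).conjTranspose)) +
      2 * Real.cos φ * Real.sin φ * (α.re * α.im +
        halfTrace (symProd (offHerm 0 C D) (offHerm (Real.pi / 2) C D))) +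
      Real.sin φ ^ 2 * (α.im ^ 2 + halfTrace (offHerm (Real.pi / 2) C D *
        (offHerm (Real.pi / 2) C D).conjTranspose)) := by
  rw [eigMean, offHerm_eq, gram_eq, halfTrace_combo, dirCoord]
  ring

theorem eigDisc_eq (C D : Matrix (Fin 2) (Fin 2) ℂ) (φ : ℝ) :
    eigDisc C D φ =
      pauliDot (((Real.cos φ ^ 2 : ℝ) : ℂ) • (offHerm 0 C D * (offHerm 0 C D).conjTranspose) +
        ((2 * Real.cos φ * Real.sin φ : ℝ) : ℂ) •
          symProd (offHerm 0 C D) (offHerm (Real.pi / 2) C D) +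
        ((Real.sin φ ^ 2 : ℝ) : ℂ) • (offHerm (Real.pi / 2) C D *
          (offHerm (Real.pi / 2) C D).conjTranspose))
      (((Real.cos φ ^ 2 : ℝ) : ℂ) • (offHerm 0 C D * (offHerm 0 C D).conjTranspose) +
        ((2 * Real.cos φ * Real.sin φ : ℝ) : ℂ) •
          symProd (offHerm 0 C D) (offHerm (Real.pi / 2) C D) +
        ((Real.sin φ ^ 2 : ℝ) : ℂ) • (offHerm (Real.pi / 2) C D *
          (offHerm (Real.pi / 2) C D).conjTranspose)) := by
  rw [eigDisc, offHerm_eq, gram_eq]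

theorem eigMean_add_pi (α : ℂ) (C D : Matrix (Fin 2) (Fin 2) ℂ) (φ : ℝ) :
    eigMean α C D (φ + Real.pi) = eigMean α C D φ := by
  simp only [eigMean_eq, Real.cos_add_pi, Real.sin_add_pi]; ring

theorem eigDisc_add_pi (C D : Matrix (Fin 2) (Fin 2) ℂ) (φ : ℝ) :
    eigDisc C D (φ + Real.pi) = eigDisc C D φ := by
  simp only [eigDisc_eq, pauliDot_combo, Real.cos_add_pi, Real.sin_add_pi]; ring

theorem eigMean_rot (θ : ℝ) (α : ℂ) (C D : Matrix (Fin 2) (Fin 2) ℂ) (φ : ℝ) :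
    eigMean (Complex.exp (-(θ * Complex.I)) * α) (rot θ C) (rot θ D) φ =
      eigMean α C D (φ + θ) := by
  have h := dirCoord_exp_mul φ (-θ) α
  rw [Complex.ofReal_neg, neg_mul, sub_neg_eq_add] at h
  rw [eigMean, eigMean, offHerm_rot, h]

theorem eigDisc_rot (θ : ℝ) (C D : Matrix (Fin 2) (Fin 2) ℂ) (φ : ℝ) :
    eigDisc (rot θ C) (rot θ D) φ = eigDisc C D (φ + θ) := by
  rw [eigDisc, eigDisc, offHerm_rot]

/-! ### The support function of a bi-elliptical numerical range -/

theorem analyticAt_eigMean (α : ℂ) (C D : Matrix (Fin 2) (Fin 2) ℂ) (φ : ℝ) :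
    AnalyticAt ℝ (eigMean α C D) φ := by
  have hs : AnalyticAt ℝ Real.sin φ := Real.analyticAt_sin
  have hc : AnalyticAt ℝ Real.cos φ := Real.analyticAt_cos
  rw [funext (eigMean_eq α C D)]
  fun_prop

theorem analyticAt_eigDisc (C D : Matrix (Fin 2) (Fin 2) ℂ) (φ : ℝ) :
    AnalyticAt ℝ (eigDisc C D) φ := by
  have hs : AnalyticAt ℝ Real.sin φ := Real.analyticAt_sin
  have hc : AnalyticAt ℝ Real.cos φ := Real.analyticAt_cos
  simp only [funext (eigDisc_eq C D), pauliDot_combo]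
  fun_prop

theorem analyticAt_dirCoord (c : ℂ) (φ : ℝ) : AnalyticAt ℝ (fun φ => dirCoord φ c) φ := by
  have hs : AnalyticAt ℝ Real.sin φ := Real.analyticAt_sin
  have hc : AnalyticAt ℝ Real.cos φ := Real.analyticAt_cos
  unfold dirCoord
  fun_prop

theorem analyticAt_halfWidthSq (a b ψ φ : ℝ) : AnalyticAt ℝ (halfWidthSq a b ψ) φ := by
  have hsub : AnalyticAt ℝ (fun x : ℝ => x - ψ) φ := by fun_prop
  have hs : AnalyticAt ℝ (fun x : ℝ => Real.sin (x - ψ)) φ :=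
    AnalyticAt.fun_comp (g := Real.sin) (f := fun x => x - ψ) Real.analyticAt_sin hsub
  have hc : AnalyticAt ℝ (fun x : ℝ => Real.cos (x - ψ)) φ :=
    AnalyticAt.fun_comp (g := Real.cos) (f := fun x => x - ψ) Real.analyticAt_cos hsub
  unfold halfWidthSq
  fun_prop

theorem analyticAt_ellipseSupport (c : ℂ) {a b : ℝ} (ha : 0 < a) (hb : 0 < b) (ψ φ : ℝ) :
    AnalyticAt ℝ (ellipseSupport c a b ψ) φ :=
  (analyticAt_dirCoord c φ).add
    ((Real.contDiffAt_sqrt (halfWidthSq_pos ha hb ψ φ).ne').analyticAt.comp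
      (analyticAt_halfWidthSq a b ψ φ))

theorem eq_zero_of_analyticAt_of_eventually {f : ℝ → ℝ} (hf : ∀ φ, AnalyticAt ℝ f φ) {φ₀ : ℝ}
    (h : ∀ᶠ φ in nhds φ₀, f φ = 0) (φ : ℝ) : f φ = 0 :=
  AnalyticOnNhd.eqOn_zero_of_preconnected_of_eventuallyEq_zero (U := Set.univ)
    (fun x _ => hf x) isPreconnected_univ (Set.mem_univ φ₀) h (Set.mem_univ φ)

/-- The support function of an ellipse that contributes to the boundary of the numerical range is,
on an arc of directions, an eigenvalue of `Re (exp (-i φ) A)`; by analyticity it is one for all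
directions, and opposite directions give two eigenvalues with different squares. -/
theorem eigMean_eq_and_eigDisc_eq_of_dominates {α : ℂ} {C D : Matrix (Fin 2) (Fin 2) ℂ}
    {c₁ c₂ : ℂ} {a₁ b₁ ψ₁ a₂ b₂ ψ₂ : ℝ} (ha₁ : 0 < a₁) (hb₁ : 0 < b₁) (ha₂ : 0 < a₂) (hb₂ : 0 < b₂)
    (hc : c₁ ≠ 0)
    (hW : numericalRange (blockMatrix α C D) =
      convexHull ℝ (ellipse c₁ a₁ b₁ ψ₁ ∪ ellipse c₂ a₂ b₂ ψ₂))
    (hsub : ¬ ellipse c₁ a₁ b₁ ψ₁ ⊆ convexHull ℝ (ellipse c₂ a₂ b₂ ψ₂)) (φ : ℝ) :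
    eigMean α C D φ = dirCoord φ c₁ ^ 2 + halfWidthSq a₁ b₁ ψ₁ φ ∧
      eigDisc C D φ = 4 * dirCoord φ c₁ ^ 2 * halfWidthSq a₁ b₁ ψ₁ φ := by
  have hanh := analyticAt_ellipseSupport c₁ ha₁ hb₁ ψ₁
  have hanm := analyticAt_eigMean α C D
  have hand := analyticAt_eigDisc C D
  have hroot : ∀ φ,
      (ellipseSupport c₁ a₁ b₁ ψ₁ φ ^ 2 - eigMean α C D φ) ^ 2 - eigDisc C D φ = 0 := by
    obtain ⟨φ₀, hφ₀⟩ := exists_ellipseSupport_lt hsub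
    refine eq_zero_of_analyticAt_of_eventually (φ₀ := φ₀)
      (fun φ => ((((hanh φ).pow 2).sub (hanm φ)).pow 2).sub (hand φ)) ?_
    have hev : ∀ᶠ φ in nhds φ₀, ellipseSupport c₂ a₂ b₂ ψ₂ φ < ellipseSupport c₁ a₁ b₁ ψ₁ φ :=
      (analyticAt_ellipseSupport c₂ ha₂ hb₂ ψ₂ φ₀).continuousAt.eventually_lt
        (hanh φ₀).continuousAt hφ₀
    filter_upwards [hev] with φ hφ
    have hdet : (((ellipseSupport c₁ a₁ b₁ ψ₁ φ : ℝ) : ℂ) •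
        (1 : Matrix (Fin 2 ⊕ Fin 2) (Fin 2 ⊕ Fin 2) ℂ) -
          hermPart φ (blockMatrix α C D)).det = 0 := by
      apply det_eq_zero_of_isGreatest_dirCoord
      · intro z hz
        rw [hW] at hz
        refine dirCoord_le_of_mem_convexHull ?_ hz
        rintro w (hw | hw)
        · exact dirCoord_le_ellipseSupport φ hw
        · exact (dirCoord_le_ellipseSupport φ hw).trans hφ.le
      · obtain ⟨z, hz, hzφ⟩ := exists_mem_ellipse_dirCoord_eq c₁ a₁ b₁ ψ₁ φ
        exact ⟨z, hW ▸ subset_convexHull ℝ _ (Or.inl hz), hzφ⟩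
    rw [det_smul_one_sub_hermPart] at hdet
    exact_mod_cast hdet
  have hne : ∀ φ, dirCoord φ c₁ ≠ 0 →
      eigMean α C D φ = dirCoord φ c₁ ^ 2 + halfWidthSq a₁ b₁ ψ₁ φ ∧
      eigDisc C D φ = 4 * dirCoord φ c₁ ^ 2 * halfWidthSq a₁ b₁ ψ₁ φ := by
    intro φ hu
    have h1 := hroot φ
    have h2 := hroot (φ + Real.pi)
    simp only [ellipseSupport, dirCoord_add_pi, halfWidthSq_add_pi, eigMean_add_pi,
      eigDisc_add_pi] at h1 h2
    have hw := halfWidthSq_pos ha₁ hb₁ ψ₁ φ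
    have hr := Real.sq_sqrt hw.le
    have hr0 : Real.sqrt (halfWidthSq a₁ b₁ ψ₁ φ) ≠ 0 := (Real.sqrt_pos.2 hw).ne'
    set r := Real.sqrt (halfWidthSq a₁ b₁ ψ₁ φ)
    set u := dirCoord φ c₁
    set m := eigMean α C D φ
    have h3 : u * r * (m - (u ^ 2 + r ^ 2)) = 0 := by linear_combination (h2 - h1) / 8
    have h4 : m = u ^ 2 + r ^ 2 := by
      have := (mul_eq_zero.1 h3).resolve_left (mul_ne_zero hu hr0)
      linarith
    rw [← hr]
    refine ⟨h4, ?_⟩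
    rw [h4] at h1
    linear_combination -h1
  have hu₀ : ∀ᶠ φ in nhds c₁.arg, dirCoord φ c₁ ≠ 0 := by
    apply (analyticAt_dirCoord c₁ _).continuousAt.eventually_ne
    rw [dirCoord_arg]
    exact norm_ne_zero_iff.2 hc
  have hanu := analyticAt_dirCoord c₁
  have hanw := analyticAt_halfWidthSq a₁ b₁ ψ₁
  constructor
  · refine sub_eq_zero.1 (eq_zero_of_analyticAt_of_eventually (φ₀ := c₁.arg)
      (f := fun φ => eigMean α C D φ - (dirCoord φ c₁ ^ 2 + halfWidthSq a₁ b₁ ψ₁ φ))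
      (fun φ => (hanm φ).sub (((hanu φ).pow 2).add (hanw φ))) ?_ φ)
    filter_upwards [hu₀] with φ hφ
    exact sub_eq_zero.2 (hne φ hφ).1
  · refine sub_eq_zero.1 (eq_zero_of_analyticAt_of_eventually (φ₀ := c₁.arg)
      (f := fun φ => eigDisc C D φ - 4 * dirCoord φ c₁ ^ 2 * halfWidthSq a₁ b₁ ψ₁ φ)
      (fun φ => (hand φ).sub ((analyticAt_const.mul ((hanu φ).pow 2)).mul (hanw φ))) ?_ φ)
    filter_upwards [hu₀] with φ hφ
    exact sub_eq_zero.2 (hne φ hφ).2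

/-- If the largest eigenvalue of `Re (exp (-i φ) A)` is `|u| + √w`, the numerical range is the
convex hull of an ellipse and its mirror image in the origin, as both are compact convex sets with
the same support function. -/
theorem isBiElliptical_of_eigMean_eq_of_eigDisc_eq {α : ℂ} {C D : Matrix (Fin 2) (Fin 2) ℂ} {c : ℂ}
    {a b ψ : ℝ} (hc : c ≠ 0) (ha : 0 < a) (hb : 0 < b)
    (h : ∀ φ, eigMean α C D φ = dirCoord φ c ^ 2 + halfWidthSq a b ψ φ ∧
      eigDisc C D φ = 4 * dirCoord φ c ^ 2 * halfWidthSq a b ψ φ) :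
    IsBiElliptical (numericalRange (blockMatrix α C D)) := by
  refine ⟨c, -c, a, b, ψ, a, b, ψ, ha, hb, ha, hb, self_ne_neg.2 hc,
    not_ellipse_subset_convexHull_neg hc a b ψ, ?_, ?_⟩
  · have := not_ellipse_subset_convexHull_neg (neg_ne_zero.2 hc) a b ψ
    rwa [neg_neg] at this
  have hfac : ∀ φ x : ℝ, (((x : ℝ) : ℂ) • (1 : Matrix (Fin 2 ⊕ Fin 2) (Fin 2 ⊕ Fin 2) ℂ) -
      hermPart φ (blockMatrix α C D)).det = 0 ↔
        (x ^ 2 - (dirCoord φ c ^ 2 + halfWidthSq a b ψ φ)) ^ 2 =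
          4 * dirCoord φ c ^ 2 * halfWidthSq a b ψ φ := by
    intro φ x
    rw [det_smul_one_sub_hermPart, (h φ).1, (h φ).2, Complex.ofReal_eq_zero, sub_eq_zero]
  apply subset_antisymm
  · refine subset_of_dirCoord_le (convex_convexHull ℝ _)
      (isCompact_convexHull_ellipse_union ..).isClosed fun φ y hy => ?_
    obtain ⟨z, hz, hmax⟩ := (isCompact_numericalRange (blockMatrix α C D)).exists_isMaxOn ⟨y, hy⟩
      (continuous_dirCoord φ).continuousOn
    have hdet := (hfac φ _).1 (det_eq_zero_of_isGreatest_dirCoord hmax ⟨z, hz, rfl⟩)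
    have hle : dirCoord φ z ≤ |dirCoord φ c| + Real.sqrt (halfWidthSq a b ψ φ) := by
      have hr := Real.sq_sqrt (halfWidthSq_pos ha hb ψ φ).le
      have hr0 := Real.sqrt_nonneg (halfWidthSq a b ψ φ)
      set r := Real.sqrt (halfWidthSq a b ψ φ)
      rw [← hr] at hdet
      have habs : |dirCoord φ c| ^ 2 = dirCoord φ c ^ 2 := sq_abs _
      have h0 := abs_nonneg (dirCoord φ c)
      rw [← habs] at hdet
      have h1 : dirCoord φ z ^ 2 - (|dirCoord φ c| ^ 2 + r ^ 2) ≤ 2 * |dirCoord φ c| * r :=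
        le_of_sq_le_sq (by rw [hdet]; apply le_of_eq; ring) (by positivity)
      apply le_of_sq_le_sq _ (by positivity)
      linarith
    have hyz : dirCoord φ y ≤ dirCoord φ z := hmax hy
    rcases abs_cases (dirCoord φ c) with ⟨habs, -⟩ | ⟨habs, -⟩
    · obtain ⟨w, hw, hwφ⟩ := exists_mem_ellipse_dirCoord_eq c a b ψ φ
      refine ⟨w, subset_convexHull ℝ _ (Or.inl hw), ?_⟩
      rw [hwφ, ellipseSupport, ← habs]
      exact hyz.trans hle
    · obtain ⟨w, hw, hwφ⟩ := exists_mem_ellipse_dirCoord_eq (-c) a b ψ φ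
      refine ⟨w, subset_convexHull ℝ _ (Or.inr hw), ?_⟩
      rw [hwφ, ellipseSupport, dirCoord_neg, ← habs]
      exact hyz.trans hle
  · apply convexHull_min _ (convex_numericalRange _)
    refine subset_of_dirCoord_le (convex_numericalRange _)
      (isCompact_numericalRange _).isClosed fun φ y hy => ?_
    have hr := Real.sq_sqrt (halfWidthSq_pos ha hb ψ φ).le
    rcases hy with hy | hy
    · obtain ⟨z, hz, hzφ⟩ := exists_dirCoord_eq_of_det_eq_zero ((hfac φ
        (dirCoord φ c + Real.sqrt (halfWidthSq a b ψ φ))).2 (by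
          generalize Real.sqrt (halfWidthSq a b ψ φ) = r at *; rw [← hr]; ring))
      exact ⟨z, hz, (dirCoord_le_ellipseSupport φ hy).trans_eq hzφ.symm⟩
    · obtain ⟨z, hz, hzφ⟩ := exists_dirCoord_eq_of_det_eq_zero ((hfac φ
        (dirCoord φ (-c) + Real.sqrt (halfWidthSq a b ψ φ))).2 (by
          generalize Real.sqrt (halfWidthSq a b ψ φ) = r at *
          rw [← hr, dirCoord_neg]; ring))
      exact ⟨z, hz, (dirCoord_le_ellipseSupport φ hy).trans_eq hzφ.symm⟩

theorem isBiElliptical_numericalRange_iff (α : ℂ) (C D : Matrix (Fin 2) (Fin 2) ℂ) :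
    IsBiElliptical (numericalRange (blockMatrix α C D)) ↔
      ∃ (c : ℂ) (a b ψ : ℝ), c ≠ 0 ∧ 0 < a ∧ 0 < b ∧ ∀ φ,
        eigMean α C D φ = dirCoord φ c ^ 2 + halfWidthSq a b ψ φ ∧
        eigDisc C D φ = 4 * dirCoord φ c ^ 2 * halfWidthSq a b ψ φ := by
  constructor
  · rintro ⟨c₁, c₂, a₁, b₁, ψ₁, a₂, b₂, ψ₂, ha₁, hb₁, ha₂, hb₂, hne, h12, h21, hW⟩
    rcases eq_or_ne c₁ 0 with h0 | h0
    · refine ⟨c₂, a₂, b₂, ψ₂, fun h => hne (h0.trans h.symm), ha₂, hb₂, ?_⟩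
      rw [Set.union_comm] at hW
      exact eigMean_eq_and_eigDisc_eq_of_dominates ha₂ hb₂ ha₁ hb₁
        (fun h => hne (h0.trans h.symm)) hW h21
    · exact ⟨c₁, a₁, b₁, ψ₁, h0, ha₁, hb₁,
        eigMean_eq_and_eigDisc_eq_of_dominates ha₁ hb₁ ha₂ hb₂ h0 hW h12⟩
  · rintro ⟨c, a, b, ψ, hc, ha, hb, h⟩
    exact isBiElliptical_of_eigMean_eq_of_eigDisc_eq hc ha hb h

/-! ### Normality and commuting Hermitian parts in Pauli coordinates -/

theorem pauliDot_self_nonneg (S : Matrix (Fin 2) (Fin 2) ℂ) : 0 ≤ pauliDot S S := by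
  unfold pauliDot; nlinarith [sq_nonneg (((S 0 0).re - (S 1 1).re) / 2), sq_nonneg (S 0 1).re,
    sq_nonneg (S 0 1).im]

theorem pauliDot_smul_smul (x y : ℝ) (S T : Matrix (Fin 2) (Fin 2) ℂ) :
    pauliDot ((x : ℂ) • S) ((y : ℂ) • T) = x * y * pauliDot S T := by
  simp [pauliDot]; ring

theorem eq_smul_one_of_pauliDot_eq_zero {S : Matrix (Fin 2) (Fin 2) ℂ} (hS : S.IsHermitian)
    (h : pauliDot S S = 0) : S = (halfTrace S : ℂ) • (1 : Matrix (Fin 2) (Fin 2) ℂ) := by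
  unfold pauliDot at h
  have h0 := sq_nonneg (((S 0 0).re - (S 1 1).re) / 2)
  have h1 := sq_nonneg (S 0 1).re
  have h2 := sq_nonneg (S 0 1).im
  have e0 : (S 0 0).re = (S 1 1).re := by
    have : (((S 0 0).re - (S 1 1).re) / 2) ^ 2 = 0 := by nlinarith
    have := pow_eq_zero_iff (two_ne_zero) |>.1 this
    linarith
  have e1 : (S 0 1).re = 0 := pow_eq_zero_iff two_ne_zero |>.1 (by nlinarith : (S 0 1).re ^ 2 = 0)
  have e2 : (S 0 1).im = 0 := pow_eq_zero_iff two_ne_zero |>.1 (by nlinarith : (S 0 1).im ^ 2 = 0)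
  have e01 : S 0 1 = 0 := Complex.ext e1 e2
  have i0 : (S 0 0).im = 0 := Complex.conj_eq_iff_im.1 (hS.apply 0 0)
  have i1 : (S 1 1).im = 0 := Complex.conj_eq_iff_im.1 (hS.apply 1 1)
  have e10 : S 1 0 = 0 := by rw [← hS.apply 1 0, e01, star_zero]
  ext i j
  fin_cases i <;> fin_cases j
  · apply Complex.ext <;> simp [halfTrace, e0, i0]
  · simpa using e01
  · simpa using e10
  · apply Complex.ext <;> simp [halfTrace, e0, i1]

theorem pauliDot_eq_zero_right {S T : Matrix (Fin 2) (Fin 2) ℂ} (hT : T.IsHermitian)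
    (h : pauliDot T T = 0) : pauliDot S T = 0 := by
  rw [eq_smul_one_of_pauliDot_eq_zero hT h]
  simp [pauliDot]

theorem halfTrace_mul_conjTranspose_nonneg (N : Matrix (Fin 2) (Fin 2) ℂ) :
    0 ≤ halfTrace (N * N.conjTranspose) := by
  simp only [halfTrace, Matrix.mul_apply, Fin.sum_univ_two, Matrix.conjTranspose_apply,
    Complex.star_def, Complex.mul_conj, ← Complex.ofReal_add, Complex.ofReal_re]
  have := Complex.normSq_nonneg
  linarith [this (N 0 0), this (N 0 1), this (N 1 0), this (N 1 1)]

open scoped ComplexOrder in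
theorem eq_zero_of_mul_conjTranspose_eq {N : Matrix (Fin 2) (Fin 2) ℂ} {μ : ℝ}
    (h : N * N.conjTranspose = (μ : ℂ) • (1 : Matrix (Fin 2) (Fin 2) ℂ)) (h0 : μ = 0) : N = 0 := by
  rw [← Matrix.self_mul_conjTranspose_eq_zero, h, h0, Complex.ofReal_zero, zero_smul]

theorem isScalarMultipleOfUnitary_iff (N : Matrix (Fin 2) (Fin 2) ℂ) :
    IsScalarMultipleOfUnitary N ↔
      pauliDot (N * N.conjTranspose) (N * N.conjTranspose) = 0 := by
  constructor
  · rintro ⟨c, U, hU, rfl⟩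
    have h : (c • U) * (c • U).conjTranspose =
        (c * star c) • (1 : Matrix (Fin 2) (Fin 2) ℂ) := by
      rw [Matrix.conjTranspose_smul, Matrix.smul_mul, Matrix.mul_smul, smul_smul,
        ← Matrix.star_eq_conjTranspose, Matrix.mem_unitaryGroup_iff.1 hU]
    rw [h]
    simp [pauliDot]
  · intro h
    have hμ := eq_smul_one_of_pauliDot_eq_zero (Matrix.isHermitian_mul_conjTranspose_self N) h
    have hμ0 := halfTrace_mul_conjTranspose_nonneg N
    generalize halfTrace (N * N.conjTranspose) = μ at hμ hμ0
    rcases hμ0.eq_or_lt with h0 | h0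
    · refine ⟨0, 1, one_mem _, ?_⟩
      rw [zero_smul, eq_zero_of_mul_conjTranspose_eq hμ h0.symm]
    · have hr : Real.sqrt μ ≠ 0 := (Real.sqrt_pos.2 h0).ne'
      refine ⟨(Real.sqrt μ : ℂ), ((Real.sqrt μ)⁻¹ : ℝ) • N, ?_, ?_⟩
      · rw [Matrix.mem_unitaryGroup_iff, star_smul, Matrix.smul_mul, Matrix.mul_smul,
          Matrix.star_eq_conjTranspose, hμ, smul_smul, star_trivial, ← mul_inv,
          Real.mul_self_sqrt h0.le]
        have hc : (μ : ℂ) ≠ 0 := Complex.ofReal_ne_zero.2 h0.ne'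
        ext i j
        simp [← mul_assoc, inv_mul_cancel₀ hc]
      · ext i j
        simp [hr]

theorem isStarNormal_smul_iff {k : ℂ} (hk : k ≠ 0) (X : Matrix (Fin 2) (Fin 2) ℂ) :
    IsStarNormal (k • X) ↔ IsStarNormal X := by
  have h : star k * k ≠ 0 := mul_ne_zero (star_ne_zero.2 hk) hk
  rw [isStarNormal_iff, isStarNormal_iff, commute_iff_eq, commute_iff_eq, star_smul,
    Matrix.smul_mul, Matrix.mul_smul, Matrix.smul_mul, Matrix.mul_smul, smul_smul, smul_smul,
    mul_comm k]
  exact (smul_right_injective _ h).eq_iff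

theorem isStarNormal_add_smul_one_iff (k : ℂ) (X : Matrix (Fin 2) (Fin 2) ℂ) :
    IsStarNormal (X + k • (1 : Matrix (Fin 2) (Fin 2) ℂ)) ↔ IsStarNormal X := by
  rw [isStarNormal_iff, isStarNormal_iff, commute_iff_eq, commute_iff_eq, star_add, star_smul,
    star_one]
  simp only [add_mul, mul_add, Matrix.smul_mul, Matrix.mul_smul, one_mul, mul_one]
  constructor
  · intro h
    have := congrArg (fun Y => Y - (k • star X + star k • X + star k • k • 1)) h
    rw [smul_comm k (star k)] at this
    convert! this using 1 <;> abel
  · intro h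
    rw [h, smul_comm k (star k)]
    abel

/-- For `X = R + i J` with Hermitian `R`, `J`, the commutator `X Xᴴ - Xᴴ X` has as its Pauli vector,
up to sign, four times the cross product of those of `R` and `J`; its squared norm is written by
means of Lagrange's identity. -/
theorem pauliDot_commutator (X : Matrix (Fin 2) (Fin 2) ℂ) :
    pauliDot (X * X.conjTranspose - X.conjTranspose * X)
        (X * X.conjTranspose - X.conjTranspose * X) =
      16 * (pauliDot (symProd X 1) (symProd X 1) *
          pauliDot (symProd (-Complex.I • X) 1) (symProd (-Complex.I • X) 1) -
        pauliDot (symProd X 1) (symProd (-Complex.I • X) 1) ^ 2) := by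
  simp [pauliDot, symProd, Matrix.mul_apply, Fin.sum_univ_two]
  ring

/-- Let `X = R + i J` with Hermitian `R`, `J`, let `r`, `j` be their Pauli vectors and `j₀` half the
trace of `J`. Up to a multiple of `r`, the Pauli vector of `Xᴴ X` is `2 (j₀ j ± r × j)`, the sign
depending on the orientation of the coordinates. The identity computes the squared norm of its cross
product with `r`; the two contributions `j × r` and `(r × j) × r` are orthogonal. -/
theorem pauliDot_gram_cross (X : Matrix (Fin 2) (Fin 2) ℂ) :
    4 * (pauliDot (X.conjTranspose * X) (X.conjTranspose * X) *
        pauliDot (symProd X 1) (symProd X 1) -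
      pauliDot (X.conjTranspose * X) (symProd X 1) ^ 2) =
    pauliDot (X * X.conjTranspose - X.conjTranspose * X)
        (X * X.conjTranspose - X.conjTranspose * X) *
      (halfTrace (symProd (-Complex.I • X) 1) ^ 2 + pauliDot (symProd X 1) (symProd X 1)) := by
  simp [pauliDot, symProd, halfTrace, Matrix.mul_apply, Fin.sum_univ_two]
  ring

theorem isStarNormal_iff_pauliDot (X : Matrix (Fin 2) (Fin 2) ℂ) :
    IsStarNormal X ↔ pauliDot (X * X.conjTranspose - X.conjTranspose * X)
      (X * X.conjTranspose - X.conjTranspose * X) = 0 := by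
  rw [isStarNormal_iff, commute_iff_eq, Matrix.star_eq_conjTranspose]
  constructor
  · intro h
    rw [h, sub_self]
    simp [pauliDot]
  · intro h
    have hH : (X * X.conjTranspose - X.conjTranspose * X).IsHermitian :=
      (Matrix.isHermitian_mul_conjTranspose_self X).sub
        (Matrix.isHermitian_conjTranspose_mul_self X)
    have h1 := eq_smul_one_of_pauliDot_eq_zero hH h
    have h2 : halfTrace (X * X.conjTranspose - X.conjTranspose * X) = 0 := by
      simp [halfTrace, Matrix.mul_apply, Fin.sum_univ_two]
    rw [h2, Complex.ofReal_zero, zero_smul, sub_eq_zero] at h1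
    exact h1.symm

theorem not_isStarNormal_iff_gram_cross (X : Matrix (Fin 2) (Fin 2) ℂ) :
    ¬ IsStarNormal X ↔ 0 < pauliDot (X.conjTranspose * X) (X.conjTranspose * X) *
        pauliDot (symProd X 1) (symProd X 1) -
      pauliDot (X.conjTranspose * X) (symProd X 1) ^ 2 := by
  have hg := pauliDot_gram_cross X
  have hn := pauliDot_self_nonneg (X * X.conjTranspose - X.conjTranspose * X)
  have hR := pauliDot_self_nonneg (symProd X 1)
  rw [isStarNormal_iff_pauliDot]
  constructor
  · intro h
    have hpos := lt_of_le_of_ne hn (Ne.symm h)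
    have hRpos : 0 < pauliDot (symProd X 1) (symProd X 1) := by
      refine lt_of_le_of_ne hR fun h0 => ?_
      rw [pauliDot_commutator, ← h0] at hpos
      nlinarith [sq_nonneg (pauliDot (symProd X 1) (symProd (-Complex.I • X) 1))]
    have : 0 < pauliDot (X * X.conjTranspose - X.conjTranspose * X)
        (X * X.conjTranspose - X.conjTranspose * X) *
      (halfTrace (symProd (-Complex.I • X) 1) ^ 2 + pauliDot (symProd X 1) (symProd X 1)) := by
      positivity
    linarith
  · intro h h0
    rw [h0, zero_mul] at hg
    linarith

/-- If `M` is a multiple of a unitary matrix, then `M (Lᴴ + i Mᴴ)` fails to be normal exactly when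
the traceless parts of `L Lᴴ` and of `symProd L M` are linearly independent. -/
theorem not_isStarNormal_iff {L M : Matrix (Fin 2) (Fin 2) ℂ}
    (hM : pauliDot (M * M.conjTranspose) (M * M.conjTranspose) = 0) :
    ¬ IsStarNormal (M * (L.conjTranspose + Complex.I • M.conjTranspose)) ↔
      0 < pauliDot (L * L.conjTranspose) (L * L.conjTranspose) *
          pauliDot (symProd L M) (symProd L M) -
        pauliDot (L * L.conjTranspose) (symProd L M) ^ 2 := by
  have hμ := eq_smul_one_of_pauliDot_eq_zero (Matrix.isHermitian_mul_conjTranspose_self M) hM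
  generalize halfTrace (M * M.conjTranspose) = μ at hμ
  rw [mul_add, Matrix.mul_smul, hμ, smul_smul, isStarNormal_add_smul_one_iff,
    not_isStarNormal_iff_gram_cross]
  have hsym : symProd (M * L.conjTranspose) 1 = symProd L M := by
    simp [symProd, add_comm]
  rw [hsym]
  rcases eq_or_ne μ 0 with h0 | h0
  · have hM0 : M = 0 := eq_zero_of_mul_conjTranspose_eq hμ h0
    simp [hM0, symProd, pauliDot]
  · have hMM : M.conjTranspose * M = (μ : ℂ) • (1 : Matrix (Fin 2) (Fin 2) ℂ) := by
      have hc : (μ : ℂ) ≠ 0 := Complex.ofReal_ne_zero.2 h0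
      have h1 : M * ((μ : ℂ)⁻¹ • M.conjTranspose) = 1 := by
        rw [Matrix.mul_smul, hμ, smul_smul, inv_mul_cancel₀ hc, one_smul]
      have h2 := mul_eq_one_comm.1 h1
      rw [Matrix.smul_mul] at h2
      rw [← h2, smul_smul, mul_inv_cancel₀ hc, one_smul]
    have hX : (M * L.conjTranspose).conjTranspose * (M * L.conjTranspose) =
        (μ : ℂ) • (L * L.conjTranspose) := by
      rw [Matrix.conjTranspose_mul, Matrix.conjTranspose_conjTranspose, Matrix.mul_assoc,
        ← Matrix.mul_assoc _ M, hMM, Matrix.smul_mul, Matrix.mul_smul, one_mul]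
    have h1 := pauliDot_smul_smul μ 1 (L * L.conjTranspose) (symProd L M)
    rw [Complex.ofReal_one, one_smul, mul_one] at h1
    rw [hX, pauliDot_smul_smul, h1]
    have h2 : 0 < μ ^ 2 := by positivity
    rw [show ∀ x y z : ℝ, μ * μ * x * y - (μ * z) ^ 2 = μ ^ 2 * (x * y - z ^ 2) from
      fun x y z => by ring]
    exact mul_pos_iff_of_pos_left h2

/-! ### The spectra of `A` and of `Im (A ^ 2)` -/

theorem offHerm_zero_add_I_smul (C D : Matrix (Fin 2) (Fin 2) ℂ) :
    offHerm 0 C D + Complex.I • offHerm (Real.pi / 2) C D = C := by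
  have h1 : Complex.exp (((Real.pi / 2 : ℝ) : ℂ) * Complex.I) = Complex.I := by
    push_cast; exact Complex.exp_pi_div_two_mul_I
  simp only [offHerm, Complex.exp_neg, h1, Complex.inv_I]
  ext i j
  simp
  linear_combination (-(2⁻¹ : ℂ) * C i j + 2⁻¹ * (starRingEnd ℂ) (D j i)) * Complex.I_sq

theorem mul_eq_gram (L M : Matrix (Fin 2) (Fin 2) ℂ) :
    (L + Complex.I • M) * (L.conjTranspose + Complex.I • M.conjTranspose) =
      (L * L.conjTranspose - M * M.conjTranspose) +
        Complex.I • ((2 : ℂ) • symProd L M) := by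
  simp only [symProd, add_mul, mul_add, Matrix.smul_mul, Matrix.mul_smul, smul_smul,
    Complex.I_mul_I]
  rw [mul_inv_cancel₀ two_ne_zero]
  module

theorem imPart_add_I_smul {S T : Matrix (Fin 2) (Fin 2) ℂ} (hS : S.IsHermitian)
    (hT : T.IsHermitian) : imPart (S + Complex.I • T) = T := by
  rw [imPart_eq, Matrix.conjTranspose_add, Matrix.conjTranspose_smul, hS.eq, hT.eq]
  ext i j
  simp
  ring_nf
  simp

theorem isHermitian_real_smul {S : Matrix (Fin 2) (Fin 2) ℂ} (hS : S.IsHermitian) (x : ℝ) :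
    ((x : ℂ) • S).IsHermitian := by
  rw [Matrix.IsHermitian, Matrix.conjTranspose_smul, hS.eq]; simp

theorem smul_one_add_mul_eq (α : ℂ) (C D : Matrix (Fin 2) (Fin 2) ℂ) :
    α ^ 2 • (1 : Matrix (Fin 2) (Fin 2) ℂ) + C * D =
      ((((α ^ 2).re : ℝ) : ℂ) • (1 : Matrix (Fin 2) (Fin 2) ℂ) +
        (offHerm 0 C D * (offHerm 0 C D).conjTranspose -
          offHerm (Real.pi / 2) C D * (offHerm (Real.pi / 2) C D).conjTranspose)) +
      Complex.I • ((((α ^ 2).im : ℝ) : ℂ) • (1 : Matrix (Fin 2) (Fin 2) ℂ) +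
        ((2 : ℝ) : ℂ) • symProd (offHerm 0 C D) (offHerm (Real.pi / 2) C D)) := by
  have h := mul_eq_gram (offHerm 0 C D) (offHerm (Real.pi / 2) C D)
  rw [offHerm_zero_add_I_smul] at h
  have hD := offHerm_zero_add_I_smul D C
  rw [← conjTranspose_offHerm 0 C D, ← conjTranspose_offHerm (Real.pi / 2) C D] at hD
  rw [hD] at h
  rw [h]
  conv_lhs => rw [← Complex.re_add_im (α ^ 2)]
  push_cast
  module

theorem isHermitian_re_part (x : ℝ) (L M : Matrix (Fin 2) (Fin 2) ℂ) :
    ((x : ℂ) • (1 : Matrix (Fin 2) (Fin 2) ℂ) +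
      (L * L.conjTranspose - M * M.conjTranspose)).IsHermitian :=
  (isHermitian_real_smul Matrix.isHermitian_one x).add
    ((Matrix.isHermitian_mul_conjTranspose_self L).sub
      (Matrix.isHermitian_mul_conjTranspose_self M))

theorem isHermitian_im_part (x : ℝ) (L M : Matrix (Fin 2) (Fin 2) ℂ) :
    ((x : ℂ) • (1 : Matrix (Fin 2) (Fin 2) ℂ) +
      ((2 : ℝ) : ℂ) • symProd L M).IsHermitian :=
  (isHermitian_real_smul Matrix.isHermitian_one x).add
    (isHermitian_real_smul (isHermitian_symProd L M) 2)

theorem imPart_blockMatrix_sq (α : ℂ) (C D : Matrix (Fin 2) (Fin 2) ℂ) :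
    imPart (blockMatrix α C D ^ 2) = Matrix.fromBlocks
      ((((α ^ 2).im : ℝ) : ℂ) • (1 : Matrix (Fin 2) (Fin 2) ℂ) +
        ((2 : ℝ) : ℂ) • symProd (offHerm 0 C D) (offHerm (Real.pi / 2) C D)) 0 0
      ((((α ^ 2).im : ℝ) : ℂ) • (1 : Matrix (Fin 2) (Fin 2) ℂ) +
        ((2 : ℝ) : ℂ) • symProd (offHerm 0 C D).conjTranspose
          (offHerm (Real.pi / 2) C D).conjTranspose) := by
  have h : blockMatrix α C D ^ 2 = Matrix.fromBlocks
      (α ^ 2 • (1 : Matrix (Fin 2) (Fin 2) ℂ) + C * D) 0 0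
      (α ^ 2 • (1 : Matrix (Fin 2) (Fin 2) ℂ) + D * C) := by
    rw [sq, blockMatrix, Matrix.fromBlocks_multiply]
    simp [smul_smul, sq, add_comm]
  have hd : ∀ X Y : Matrix (Fin 2) (Fin 2) ℂ, imPart (Matrix.fromBlocks X 0 0 Y) =
      Matrix.fromBlocks (imPart X) 0 0 (imPart Y) := by
    intro X Y
    rw [imPart_eq, imPart_eq, imPart_eq, Matrix.fromBlocks_conjTranspose, sub_eq_add_neg,
      Matrix.fromBlocks_neg, Matrix.fromBlocks_add, Matrix.fromBlocks_smul]
    simp [sub_eq_add_neg]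
  rw [h, hd, smul_one_add_mul_eq, smul_one_add_mul_eq α D C,
    imPart_add_I_smul (isHermitian_re_part ..) (isHermitian_im_part ..),
    imPart_add_I_smul (isHermitian_re_part ..) (isHermitian_im_part ..), conjTranspose_offHerm,
    conjTranspose_offHerm]

theorem det_smul_one_sub_im_part (x : ℝ) (L M : Matrix (Fin 2) (Fin 2) ℂ) (z : ℂ) :
    (z • (1 : Matrix (Fin 2) (Fin 2) ℂ) - ((x : ℂ) • (1 : Matrix (Fin 2) (Fin 2) ℂ) +
      ((2 : ℝ) : ℂ) • symProd L M)).det =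
      (z - (x + 2 * halfTrace (symProd L M) : ℝ)) ^ 2 -
        (4 * pauliDot (symProd L M) (symProd L M) : ℝ) := by
  rw [det_smul_one_sub_of_isHermitian (isHermitian_im_part ..)]
  congr 2
  · congr 2
    simp [halfTrace]; ring
  · simp [pauliDot]; ring

/-- If `M` is a multiple of a unitary matrix, the two diagonal blocks of `Im (A ^ 2)` are similar by
means of `M`. -/
theorem det_im_part_conjTranspose {L M : Matrix (Fin 2) (Fin 2) ℂ}
    (hM : pauliDot (M * M.conjTranspose) (M * M.conjTranspose) = 0) (x z : ℂ) :
    (z • (1 : Matrix (Fin 2) (Fin 2) ℂ) - (x • (1 : Matrix (Fin 2) (Fin 2) ℂ) +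
      ((2 : ℝ) : ℂ) • symProd L.conjTranspose M.conjTranspose)).det =
    (z • (1 : Matrix (Fin 2) (Fin 2) ℂ) - (x • (1 : Matrix (Fin 2) (Fin 2) ℂ) +
      ((2 : ℝ) : ℂ) • symProd L M)).det := by
  have hμ := eq_smul_one_of_pauliDot_eq_zero (Matrix.isHermitian_mul_conjTranspose_self M) hM
  generalize halfTrace (M * M.conjTranspose) = μ at hμ
  rcases eq_or_ne μ 0 with h0 | h0
  · have hM0 : M = 0 := eq_zero_of_mul_conjTranspose_eq hμ h0
    simp [hM0, symProd]
  · have hc : (μ : ℂ) ≠ 0 := Complex.ofReal_ne_zero.2 h0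
    have h1 : M * ((μ : ℂ)⁻¹ • M.conjTranspose) = 1 := by
      rw [Matrix.mul_smul, hμ, smul_smul, inv_mul_cancel₀ hc, one_smul]
    have hMM : M.conjTranspose * M = (μ : ℂ) • (1 : Matrix (Fin 2) (Fin 2) ℂ) := by
      have h2 := mul_eq_one_comm.1 h1
      rw [Matrix.smul_mul] at h2
      rw [← h2, smul_smul, mul_inv_cancel₀ hc, one_smul]
    have hdet : M.det ≠ 0 := by
      intro hd
      have := congrArg Matrix.det h1
      rw [Matrix.det_mul, hd, zero_mul, Matrix.det_one] at this
      exact zero_ne_one this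
    have hint : M * symProd L.conjTranspose M.conjTranspose = symProd L M * M := by
      rw [symProd, symProd, Matrix.conjTranspose_conjTranspose,
        Matrix.conjTranspose_conjTranspose, Matrix.mul_smul, Matrix.smul_mul, mul_add, add_mul,
        ← Matrix.mul_assoc, ← Matrix.mul_assoc M M.conjTranspose, hμ, Matrix.mul_assoc L, hMM]
      simp [add_comm]
    apply mul_left_cancel₀ hdet
    rw [← Matrix.det_mul, mul_comm M.det, ← Matrix.det_mul]
    congr 1
    simp only [mul_sub, sub_mul, mul_add, add_mul, Matrix.mul_smul, Matrix.smul_mul, hint,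
      mul_one, one_mul]

theorem mem_spectrum_iff_det {n : Type*} [Fintype n] [DecidableEq n] (X : Matrix n n ℂ) (z : ℂ) :
    z ∈ spectrum ℂ X ↔ (z • (1 : Matrix n n ℂ) - X).det = 0 := by
  rw [spectrum.mem_iff, Matrix.isUnit_iff_isUnit_det, isUnit_iff_ne_zero, not_not,
    Algebra.algebraMap_eq_smul_one]

theorem mem_spectrum_imPart_sq_iff {α : ℂ} {C D : Matrix (Fin 2) (Fin 2) ℂ}
    (hM : pauliDot (offHerm (Real.pi / 2) C D * (offHerm (Real.pi / 2) C D).conjTranspose)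
      (offHerm (Real.pi / 2) C D * (offHerm (Real.pi / 2) C D).conjTranspose) = 0) (z : ℂ) :
    z ∈ spectrum ℂ (imPart (blockMatrix α C D ^ 2)) ↔
      (z - (2 * (α.re * α.im +
        halfTrace (symProd (offHerm 0 C D) (offHerm (Real.pi / 2) C D))) : ℝ)) ^ 2 =
      (4 * pauliDot (symProd (offHerm 0 C D) (offHerm (Real.pi / 2) C D))
        (symProd (offHerm 0 C D) (offHerm (Real.pi / 2) C D)) : ℝ) := by
  rw [mem_spectrum_iff_det, imPart_blockMatrix_sq, ← Matrix.fromBlocks_one, Matrix.fromBlocks_smul,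
    sub_eq_add_neg, Matrix.fromBlocks_neg, Matrix.fromBlocks_add]
  simp only [smul_zero, neg_zero, add_zero, ← sub_eq_add_neg]
  rw [Matrix.det_fromBlocks_zero₂₁, det_im_part_conjTranspose hM, mul_self_eq_zero,
    det_smul_one_sub_im_part, sub_eq_zero]
  have : (α ^ 2).im = 2 * (α.re * α.im) := by rw [sq]; simp; ring
  rw [this, mul_add]

theorem charpoly_eval_blockMatrix {α : ℂ} {C D : Matrix (Fin 2) (Fin 2) ℂ}
    (hM : pauliDot (offHerm (Real.pi / 2) C D * (offHerm (Real.pi / 2) C D).conjTranspose)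
      (offHerm (Real.pi / 2) C D * (offHerm (Real.pi / 2) C D).conjTranspose) = 0) (z : ℂ) :
    (blockMatrix α C D).charpoly.eval z =
      (z ^ 2 - (((α.re ^ 2 + halfTrace (offHerm 0 C D * (offHerm 0 C D).conjTranspose)) -
          (α.im ^ 2 + halfTrace (offHerm (Real.pi / 2) C D *
            (offHerm (Real.pi / 2) C D).conjTranspose)) : ℝ) +
        2 * Complex.I * (α.re * α.im +
          halfTrace (symProd (offHerm 0 C D) (offHerm (Real.pi / 2) C D)) : ℝ))) ^ 2 -
      (pauliDot (offHerm 0 C D * (offHerm 0 C D).conjTranspose)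
          (offHerm 0 C D * (offHerm 0 C D).conjTranspose) -
        4 * pauliDot (symProd (offHerm 0 C D) (offHerm (Real.pi / 2) C D))
          (symProd (offHerm 0 C D) (offHerm (Real.pi / 2) C D)) +
        4 * Complex.I * pauliDot (offHerm 0 C D * (offHerm 0 C D).conjTranspose)
          (symProd (offHerm 0 C D) (offHerm (Real.pi / 2) C D))) := by
  have h1 := smul_one_add_mul_eq α C D
  have hμ := eq_smul_one_of_pauliDot_eq_zero (Matrix.isHermitian_mul_conjTranspose_self _) hM
  have hz : (Matrix.scalar (Fin 2 ⊕ Fin 2)) z =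
      z • (1 : Matrix (Fin 2 ⊕ Fin 2) (Fin 2 ⊕ Fin 2) ℂ) := by
    rw [Matrix.smul_one_eq_diagonal, Matrix.scalar_apply]
  rw [Matrix.eval_charpoly, hz, det_smul_one_sub_blockMatrix, sub_smul,
    sub_sub, h1, det_smul_one_sub_add_I_smul (isHermitian_re_part ..) (isHermitian_im_part ..)]
  generalize offHerm (Real.pi / 2) C D * (offHerm (Real.pi / 2) C D).conjTranspose = U at *
  generalize halfTrace U = μ at *
  subst hμ
  generalize offHerm 0 C D * (offHerm 0 C D).conjTranspose = V at *
  generalize symProd (offHerm 0 C D) (offHerm (Real.pi / 2) C D) = W at *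
  have e1 : (α ^ 2).re = α.re ^ 2 - α.im ^ 2 := by rw [sq]; simp; ring
  have e2 : (α ^ 2).im = 2 * (α.re * α.im) := by rw [sq]; simp; ring
  have t1 : halfTrace ((((α ^ 2).re : ℝ) : ℂ) • (1 : Matrix (Fin 2) (Fin 2) ℂ) +
      (V - (μ : ℂ) • (1 : Matrix (Fin 2) (Fin 2) ℂ))) =
        (α.re ^ 2 + halfTrace V) - (α.im ^ 2 + μ) := by
    have h : ∀ x : ℝ, halfTrace ((x : ℂ) • (1 : Matrix (Fin 2) (Fin 2) ℂ) +
        (V - (μ : ℂ) • (1 : Matrix (Fin 2) (Fin 2) ℂ))) = x + halfTrace V - μ := by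
      intro x; simp [halfTrace]; ring
    rw [h, e1]; ring
  have t2 : halfTrace ((((α ^ 2).im : ℝ) : ℂ) • (1 : Matrix (Fin 2) (Fin 2) ℂ) +
      ((2 : ℝ) : ℂ) • W) = 2 * (α.re * α.im + halfTrace W) := by
    have h : ∀ x : ℝ, halfTrace ((x : ℂ) • (1 : Matrix (Fin 2) (Fin 2) ℂ) +
        ((2 : ℝ) : ℂ) • W) = x + 2 * halfTrace W := by
      intro x; simp [halfTrace]; ring
    rw [h, e2]; ring
  have t3 : ∀ x y : ℝ, pauliDot ((x : ℂ) • (1 : Matrix (Fin 2) (Fin 2) ℂ) +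
      (V - (μ : ℂ) • (1 : Matrix (Fin 2) (Fin 2) ℂ))) ((y : ℂ) •
        (1 : Matrix (Fin 2) (Fin 2) ℂ) + (V - (μ : ℂ) • (1 : Matrix (Fin 2) (Fin 2) ℂ))) =
      pauliDot V V := by
    intro x y; simp [pauliDot]
  have t4 : ∀ x y : ℝ, pauliDot ((x : ℂ) • (1 : Matrix (Fin 2) (Fin 2) ℂ) +
      ((2 : ℝ) : ℂ) • W) ((y : ℂ) • (1 : Matrix (Fin 2) (Fin 2) ℂ) + ((2 : ℝ) : ℂ) • W) =
      4 * pauliDot W W := by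
    intro x y; simp [pauliDot]; ring
  have t5 : ∀ x y : ℝ, pauliDot ((x : ℂ) • (1 : Matrix (Fin 2) (Fin 2) ℂ) +
      (V - (μ : ℂ) • (1 : Matrix (Fin 2) (Fin 2) ℂ))) ((y : ℂ) •
        (1 : Matrix (Fin 2) (Fin 2) ℂ) + ((2 : ℝ) : ℂ) • W) = 2 * pauliDot V W := by
    intro x y; simp [pauliDot]; ring
  rw [t1, t2, t3, t4, t5]
  push_cast
  ring

theorem det_imPart_blockMatrix {α : ℂ} {C D : Matrix (Fin 2) (Fin 2) ℂ}
    (hM : pauliDot (offHerm (Real.pi / 2) C D * (offHerm (Real.pi / 2) C D).conjTranspose)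
      (offHerm (Real.pi / 2) C D * (offHerm (Real.pi / 2) C D).conjTranspose) = 0) :
    Real.sqrt (imPart (blockMatrix α C D)).det.re =
      α.im ^ 2 + halfTrace (offHerm (Real.pi / 2) C D *
        (offHerm (Real.pi / 2) C D).conjTranspose) := by
  have h := det_smul_one_sub_hermPart (Real.pi / 2) 0 α C D
  have hm := eigMean_eq α C D (Real.pi / 2)
  rw [Real.cos_pi_div_two, Real.sin_pi_div_two] at hm
  have hd : eigDisc C D (Real.pi / 2) = 0 := hM
  rw [Complex.ofReal_zero, zero_smul, zero_sub, Matrix.det_neg, hd] at h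
  rw [imPart_eq_hermPart]
  have hcard : Fintype.card (Fin 2 ⊕ Fin 2) = 4 := by simp
  rw [hcard] at h
  rw [show (-1 : ℂ) ^ 4 = 1 by norm_num, one_mul] at h
  rw [h, Complex.ofReal_re, hm]
  have h0 := halfTrace_mul_conjTranspose_nonneg (offHerm (Real.pi / 2) C D)
  rw [show ∀ x y z : ℝ, (0 ^ 2 - (0 ^ 2 * x + 2 * 0 * 1 * y + 1 ^ 2 * z)) ^ 2 - 0 = z ^ 2 from
    fun x y z => by ring]
  exact Real.sqrt_sq (by positivity)

/-! ### The conditions in Pauli coordinates -/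

/-- The common form of both sides of the characterization, for an ellipse whose center is real and
at the distance `√γ` from the origin. With `L`, `M` the upper right blocks of `Re A` and `Im A`,
let `G₁₁`, `G₁₂`, `G₂₂` be the Pauli vectors of `L Lᴴ`, `symProd L M`, `M Mᴴ`, and `m₁₁`, `m₁₂`,
`m₂₂` the coefficients of `cos² φ`, `2 cos φ sin φ`, `sin² φ` in `eigMean`. The condition reads `G₂₂ = 0`,
`|G₁₂|² = γ m₂₂`, `G₁₁ · G₁₂ = 2 γ m₁₂`, `|G₁₁|² = 4 γ (m₁₁ - γ)`, with `G₁₁`, `G₁₂` linearly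
independent. -/
def PauliCondition (α : ℂ) (C D : Matrix (Fin 2) (Fin 2) ℂ) (γ : ℝ) : Prop :=
  let L := offHerm 0 C D
  let M := offHerm (Real.pi / 2) C D
  0 < γ ∧ pauliDot (M * M.conjTranspose) (M * M.conjTranspose) = 0 ∧
    pauliDot (symProd L M) (symProd L M) = γ * (α.im ^ 2 + halfTrace (M * M.conjTranspose)) ∧
    pauliDot (L * L.conjTranspose) (symProd L M) =
      2 * γ * (α.re * α.im + halfTrace (symProd L M)) ∧
    pauliDot (L * L.conjTranspose) (L * L.conjTranspose) =
      4 * γ * (α.re ^ 2 + halfTrace (L * L.conjTranspose) - γ) ∧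
    0 < pauliDot (L * L.conjTranspose) (L * L.conjTranspose) *
        pauliDot (symProd L M) (symProd L M) - pauliDot (L * L.conjTranspose) (symProd L M) ^ 2

theorem halfWidthSq_eq (a b ψ φ : ℝ) : halfWidthSq a b ψ φ =
    ((a * Real.cos ψ) ^ 2 + (b * Real.sin ψ) ^ 2) * Real.cos φ ^ 2 +
      2 * ((a ^ 2 - b ^ 2) * Real.cos ψ * Real.sin ψ) * (Real.cos φ * Real.sin φ) +
      ((a * Real.sin ψ) ^ 2 + (b * Real.cos ψ) ^ 2) * Real.sin φ ^ 2 := by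
  rw [halfWidthSq, Real.cos_sub, Real.sin_sub]; ring

/-- Every positive definite binary quadratic form is the squared half-width of an ellipse
(the principal axis theorem). -/
theorem exists_halfWidthSq_eq {x y z : ℝ} (hx : 0 < x) (h : 0 < x * z - y ^ 2) :
    ∃ a b ψ : ℝ, 0 < a ∧ 0 < b ∧ ∀ φ, halfWidthSq a b ψ φ =
      x * Real.cos φ ^ 2 + 2 * y * (Real.cos φ * Real.sin φ) + z * Real.sin φ ^ 2 := by
  set q : ℂ := ⟨(x - z) / 2, y⟩ with hq
  have hz : 0 < z := by
    by_contra! hz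
    nlinarith [mul_nonpos_of_nonneg_of_nonpos hx.le hz, sq_nonneg y]
  have hqn : ‖q‖ ^ 2 = ((x - z) / 2) ^ 2 + y ^ 2 := by
    rw [← Complex.normSq_eq_norm_sq, Complex.normSq_mk]; ring
  have hlt : ‖q‖ < (x + z) / 2 := by
    apply lt_of_pow_lt_pow_left₀ 2 (by positivity)
    rw [hqn]
    nlinarith
  have hq0 := norm_nonneg q
  refine ⟨Real.sqrt ((x + z) / 2 + ‖q‖), Real.sqrt ((x + z) / 2 - ‖q‖), q.arg / 2,
    Real.sqrt_pos.2 (by positivity), Real.sqrt_pos.2 (by linarith), fun φ => ?_⟩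
  have hc : ‖q‖ * Real.cos q.arg = (x - z) / 2 := Complex.norm_mul_cos_arg q
  have hs : ‖q‖ * Real.sin q.arg = y := Complex.norm_mul_sin_arg q
  have h2 : q.arg = 2 * (q.arg / 2) := by ring
  rw [h2, Real.cos_two_mul'] at hc
  rw [h2, Real.sin_two_mul] at hs
  have h1 := Real.sin_sq_add_cos_sq (q.arg / 2)
  rw [halfWidthSq_eq]
  simp only [mul_pow, Real.sq_sqrt (by linarith : 0 ≤ (x + z) / 2 + ‖q‖),
    Real.sq_sqrt (by linarith : 0 ≤ (x + z) / 2 - ‖q‖)]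
  linear_combination (Real.cos φ ^ 2 - Real.sin φ ^ 2) * hc +
    2 * Real.cos φ * Real.sin φ * hs + (x + z) / 2 * (Real.cos φ ^ 2 + Real.sin φ ^ 2) * h1

theorem exists_pauliCondition_iff (α : ℂ) (C D : Matrix (Fin 2) (Fin 2) ℂ) :
    (∃ γ, PauliCondition α C D γ) ↔ ∃ (r a b ψ : ℝ), 0 < r ∧ 0 < a ∧ 0 < b ∧ ∀ φ,
      eigMean α C D φ = (r * Real.cos φ) ^ 2 + halfWidthSq a b ψ φ ∧
      eigDisc C D φ = 4 * (r * Real.cos φ) ^ 2 * halfWidthSq a b ψ φ := by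
  simp only [PauliCondition, eigMean_eq, eigDisc_eq, pauliDot_combo]
  have hH := Matrix.isHermitian_mul_conjTranspose_self (offHerm (Real.pi / 2) C D)
  have hzero : ∀ S, pauliDot (offHerm (Real.pi / 2) C D *
      (offHerm (Real.pi / 2) C D).conjTranspose) (offHerm (Real.pi / 2) C D *
      (offHerm (Real.pi / 2) C D).conjTranspose) = 0 → pauliDot S (offHerm (Real.pi / 2) C D *
      (offHerm (Real.pi / 2) C D).conjTranspose) = 0 := fun S h => pauliDot_eq_zero_right hH h
  have hz1 := hzero (offHerm 0 C D * (offHerm 0 C D).conjTranspose)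
  have hz2 := hzero (symProd (offHerm 0 C D) (offHerm (Real.pi / 2) C D))
  have hg11 := pauliDot_self_nonneg (offHerm 0 C D * (offHerm 0 C D).conjTranspose)
  clear hzero hH
  generalize pauliDot (offHerm (Real.pi / 2) C D *
      (offHerm (Real.pi / 2) C D).conjTranspose) (offHerm (Real.pi / 2) C D *
      (offHerm (Real.pi / 2) C D).conjTranspose) = g₂₂ at *
  generalize pauliDot (offHerm 0 C D * (offHerm 0 C D).conjTranspose) (offHerm (Real.pi / 2) C D *
      (offHerm (Real.pi / 2) C D).conjTranspose) = k₁ at *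
  generalize pauliDot (symProd (offHerm 0 C D) (offHerm (Real.pi / 2) C D))
    (offHerm (Real.pi / 2) C D * (offHerm (Real.pi / 2) C D).conjTranspose) = k₂ at *
  generalize pauliDot (symProd (offHerm 0 C D) (offHerm (Real.pi / 2) C D))
    (symProd (offHerm 0 C D) (offHerm (Real.pi / 2) C D)) = g₁₂ at *
  generalize pauliDot (offHerm 0 C D * (offHerm 0 C D).conjTranspose)
    (symProd (offHerm 0 C D) (offHerm (Real.pi / 2) C D)) = k at *
  generalize pauliDot (offHerm 0 C D * (offHerm 0 C D).conjTranspose)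
    (offHerm 0 C D * (offHerm 0 C D).conjTranspose) = g₁₁ at *
  generalize α.re ^ 2 + halfTrace (offHerm 0 C D * (offHerm 0 C D).conjTranspose) = m₁₁ at *
  generalize α.im ^ 2 + halfTrace (offHerm (Real.pi / 2) C D *
    (offHerm (Real.pi / 2) C D).conjTranspose) = m₂₂ at *
  generalize α.re * α.im + halfTrace (symProd (offHerm 0 C D) (offHerm (Real.pi / 2) C D)) = m₁₂
    at *
  constructor
  · rintro ⟨γ, hγ, h₂₂, h₁₂, hk, h₁₁, hpos⟩
    have hdisc : 0 < (m₁₁ - γ) * m₂₂ - m₁₂ ^ 2 := by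
      have : g₁₁ * g₁₂ - k ^ 2 = 4 * γ ^ 2 * ((m₁₁ - γ) * m₂₂ - m₁₂ ^ 2) := by
        rw [h₁₁, h₁₂, hk]; ring
      rw [this] at hpos
      exact pos_of_mul_pos_right hpos (by positivity)
    have hx : 0 < m₁₁ - γ := by
      have h0 : 0 ≤ m₁₁ - γ := by
        rw [h₁₁] at hg11
        exact nonneg_of_mul_nonneg_right hg11 (by positivity)
      refine lt_of_le_of_ne h0 fun h => ?_
      rw [← h] at hdisc
      nlinarith [sq_nonneg m₁₂]
    obtain ⟨a, b, ψ, ha, hb, hw⟩ := exists_halfWidthSq_eq hx hdisc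
    refine ⟨Real.sqrt γ, a, b, ψ, Real.sqrt_pos.2 hγ, ha, hb, fun φ => ?_⟩
    rw [hw, hz1 h₂₂, hz2 h₂₂, h₂₂, h₁₁, h₁₂, hk, mul_pow, Real.sq_sqrt hγ.le]
    constructor <;> ring
  · rintro ⟨r, a, b, ψ, hr, ha, hb, h⟩
    -- Four directions suffice to compare the coefficients of the trigonometric polynomials.
    have h0 := h 0
    have h1 := h (Real.pi / 2)
    have h2 := h (Real.pi / 4)
    have h3 := h (-(Real.pi / 4))
    have hw12 : 0 < ((a * Real.cos ψ) ^ 2 + (b * Real.sin ψ) ^ 2) *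
        ((a * Real.sin ψ) ^ 2 + (b * Real.cos ψ) ^ 2) -
          ((a ^ 2 - b ^ 2) * Real.cos ψ * Real.sin ψ) ^ 2 := by
      have e : ((a * Real.cos ψ) ^ 2 + (b * Real.sin ψ) ^ 2) *
        ((a * Real.sin ψ) ^ 2 + (b * Real.cos ψ) ^ 2) -
          ((a ^ 2 - b ^ 2) * Real.cos ψ * Real.sin ψ) ^ 2 =
          a ^ 2 * b ^ 2 * (Real.sin ψ ^ 2 + Real.cos ψ ^ 2) ^ 2 := by ring
      rw [e, Real.sin_sq_add_cos_sq]
      positivity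
    simp only [halfWidthSq_eq] at h0 h1 h2 h3
    generalize (a * Real.cos ψ) ^ 2 + (b * Real.sin ψ) ^ 2 = x at *
    generalize (a * Real.sin ψ) ^ 2 + (b * Real.cos ψ) ^ 2 = z at *
    generalize (a ^ 2 - b ^ 2) * Real.cos ψ * Real.sin ψ = y at *
    rw [Real.cos_zero, Real.sin_zero] at h0
    rw [Real.cos_pi_div_two, Real.sin_pi_div_two] at h1
    rw [Real.cos_pi_div_four, Real.sin_pi_div_four] at h2
    rw [Real.cos_neg, Real.sin_neg, Real.cos_pi_div_four, Real.sin_pi_div_four] at h3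
    have hs : (Real.sqrt 2 / 2) ^ 2 = 1 / 2 := by
      rw [div_pow, Real.sq_sqrt (by norm_num)]; norm_num
    generalize Real.sqrt 2 / 2 = s at *
    have e22 : g₂₂ = 0 := by linear_combination h1.2
    have ez1 := hz1 e22
    have ez2 := hz2 e22
    subst e22 ez1 ez2
    have em11 : m₁₁ = r ^ 2 + x := by linear_combination h0.1
    have em22 : m₂₂ = z := by linear_combination h1.1
    have em12 : m₁₂ = y := by
      linear_combination h2.1 + (-(m₁₁ + 2 * m₁₂ + m₂₂) + r ^ 2 + x + 2 * y + z) * hs -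
        em11 / 2 - em22 / 2
    have eg11 : g₁₁ = 4 * r ^ 2 * x := by linear_combination h0.2
    have hs2 : s * s = 1 / 2 := by rw [← sq, hs]
    have hf2 : g₁₁ + 4 * g₁₂ + 4 * k = 4 * r ^ 2 * (x + 2 * y + z) := by
      have := h2.2
      simp only [mul_pow, mul_assoc, hs, hs2] at this
      linarith
    have hf3 : g₁₁ + 4 * g₁₂ - 4 * k = 4 * r ^ 2 * (x - 2 * y + z) := by
      have := h3.2
      simp only [mul_neg, neg_sq, mul_pow, mul_assoc, hs, hs2] at this
      linarith
    have ek : k = 2 * r ^ 2 * y := by linear_combination (hf2 - hf3) / 8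
    have eg12 : g₁₂ = r ^ 2 * z := by linear_combination (hf2 + hf3) / 8 - eg11 / 4
    refine ⟨r ^ 2, by positivity, rfl, ?_, ?_, ?_, ?_⟩
    · rw [eg12, em22]
    · rw [ek, em12]
    · rw [eg11, em11]; ring
    · rw [eg11, eg12, ek, show 4 * r ^ 2 * x * (r ^ 2 * z) - (2 * r ^ 2 * y) ^ 2 =
        4 * r ^ 4 * (x * z - y ^ 2) by ring]
      positivity

theorem charpoly_roots_eq_iff {n : Type*} [Fintype n] [DecidableEq n] (A : Matrix n n ℂ)
    (σ₁ σ₂ : ℂ) : A.charpoly.roots = {σ₁, -σ₁, σ₂, -σ₂} ↔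
      ∀ z, A.charpoly.eval z = (z ^ 2 - σ₁ ^ 2) * (z ^ 2 - σ₂ ^ 2) := by
  have hprod : ∀ z, ((({σ₁, -σ₁, σ₂, -σ₂} : Multiset ℂ).map
      fun a => Polynomial.X - Polynomial.C a).prod).eval z =
        (z ^ 2 - σ₁ ^ 2) * (z ^ 2 - σ₂ ^ 2) := by
    intro z
    simp
    ring
  constructor
  · intro h z
    rw [← hprod, ← h]
    congr 1
    exact (IsAlgClosed.splits A.charpoly).eq_prod_roots_of_monic A.charpoly_monic
  · intro h
    have : A.charpoly = (({σ₁, -σ₁, σ₂, -σ₂} : Multiset ℂ).map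
        fun a => Polynomial.X - Polynomial.C a).prod :=
      Polynomial.funext fun z => by rw [h, hprod]
    rw [this, Polynomial.roots_multiset_prod_X_sub_C]

theorem biquadratic_eq_iff (n e s t : ℂ) :
    (∀ z : ℂ, (z ^ 2 - n) ^ 2 - e = (z ^ 2 - s) * (z ^ 2 - t)) ↔
      s + t = 2 * n ∧ s * t = n ^ 2 - e := by
  constructor
  · intro h
    have h0 := h 0
    have h1 := h 1
    constructor
    · linear_combination h1 - h0
    · linear_combination -h0
  · rintro ⟨h1, h2⟩ z
    linear_combination z ^ 2 * h1 - h2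

theorem rot_zero {n : Type*} (A : Matrix n n ℂ) : rot 0 A = A := by simp [rot]

theorem spreadCondition_iff {α : ℂ} {C D : Matrix (Fin 2) (Fin 2) ℂ}
    (hM : pauliDot (offHerm (Real.pi / 2) C D * (offHerm (Real.pi / 2) C D).conjTranspose)
      (offHerm (Real.pi / 2) C D * (offHerm (Real.pi / 2) C D).conjTranspose) = 0)
    (hpos : 0 < pauliDot (offHerm 0 C D * (offHerm 0 C D).conjTranspose)
        (offHerm 0 C D * (offHerm 0 C D).conjTranspose) *
        pauliDot (symProd (offHerm 0 C D) (offHerm (Real.pi / 2) C D))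
          (symProd (offHerm 0 C D) (offHerm (Real.pi / 2) C D)) -
      pauliDot (offHerm 0 C D * (offHerm 0 C D).conjTranspose)
        (symProd (offHerm 0 C D) (offHerm (Real.pi / 2) C D)) ^ 2) :
    SpreadCondition 0 (blockMatrix α C D) ↔ ∃ γ, PauliCondition α C D γ := by
  simp only [SpreadCondition, PauliCondition, rot_zero, det_imPart_blockMatrix hM,
    charpoly_roots_eq_iff, charpoly_eval_blockMatrix hM, biquadratic_eq_iff, Set.ext_iff,
    mem_spectrum_imPart_sq_iff hM]
  have hm22 : 0 ≤ α.im ^ 2 + halfTrace (offHerm (Real.pi / 2) C D *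
      (offHerm (Real.pi / 2) C D).conjTranspose) :=
    add_nonneg (sq_nonneg _) (halfTrace_mul_conjTranspose_nonneg _)
  have hg12 := pauliDot_self_nonneg (symProd (offHerm 0 C D) (offHerm (Real.pi / 2) C D))
  generalize pauliDot (offHerm (Real.pi / 2) C D *
      (offHerm (Real.pi / 2) C D).conjTranspose) (offHerm (Real.pi / 2) C D *
      (offHerm (Real.pi / 2) C D).conjTranspose) = g₂₂ at *
  generalize pauliDot (symProd (offHerm 0 C D) (offHerm (Real.pi / 2) C D))
    (symProd (offHerm 0 C D) (offHerm (Real.pi / 2) C D)) = g₁₂ at *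
  generalize pauliDot (offHerm 0 C D * (offHerm 0 C D).conjTranspose)
    (symProd (offHerm 0 C D) (offHerm (Real.pi / 2) C D)) = k at *
  generalize pauliDot (offHerm 0 C D * (offHerm 0 C D).conjTranspose)
    (offHerm 0 C D * (offHerm 0 C D).conjTranspose) = g₁₁ at *
  generalize α.re ^ 2 + halfTrace (offHerm 0 C D * (offHerm 0 C D).conjTranspose) = m₁₁ at *
  generalize α.im ^ 2 + halfTrace (offHerm (Real.pi / 2) C D *
    (offHerm (Real.pi / 2) C D).conjTranspose) = m₂₂ at *
  generalize α.re * α.im + halfTrace (symProd (offHerm 0 C D) (offHerm (Real.pi / 2) C D)) = m₁₂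
    at *
  constructor
  · rintro ⟨σ₁, σ₂, s₁, s₂, ⟨hsum, hprod⟩, hne, hspec, heq⟩
    have h1 := (hspec s₁).2 (Or.inl rfl)
    have h2 := (hspec s₂).2 (Or.inr rfl)
    norm_cast at h1 h2
    have hs : s₁ + s₂ = 2 * (2 * m₁₂) := by
      have h3 : (s₁ - s₂) * (s₁ + s₂ - 2 * (2 * m₁₂)) = 0 := by linear_combination h1 - h2
      have := (mul_eq_zero.1 h3).resolve_left (sub_ne_zero.2 hne)
      linarith
    have hsq : (s₁ - s₂) ^ 2 = 16 * g₁₂ := by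
      linear_combination 4 * h1 + (3 * s₁ - s₂ - 4 * m₁₂) * (-hs)
    have hg0 : 0 < g₁₂ := by
      have : 0 < (s₁ - s₂) ^ 2 := by
        have := sub_ne_zero.2 hne
        positivity
      linarith
    have hsqc : ((s₁ : ℂ) - s₂) ^ 2 = 16 * g₁₂ := by exact_mod_cast hsq
    rw [hsqc] at heq
    have hm0 : m₂₂ ≠ 0 := by
      intro h0
      rw [h0] at heq
      have : (g₁₂ : ℂ) = 0 := by
        simpa using heq.symm
      exact hg0.ne' (by exact_mod_cast this)
    have hmpos : 0 < m₂₂ := lt_of_le_of_ne hm22 hm0.symm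
    set γ : ℝ := g₁₂ / m₂₂ with hγ
    have hγm : g₁₂ = γ * m₂₂ := by rw [hγ]; field_simp
    have hσ : (σ₁ + σ₂) ^ 2 = 4 * γ := by
      have hmc : (m₂₂ : ℂ) ≠ 0 := Complex.ofReal_ne_zero.2 hm0
      apply mul_left_cancel₀ hmc
      have : (g₁₂ : ℂ) = γ * m₂₂ := by exact_mod_cast hγm
      linear_combination heq / 4 + 4 * this
    -- Eliminating `σ₁`, `σ₂` from their sum and the symmetric functions of their squares.
    have helim : (4 * (γ : ℂ) ^ 2 - 4 * γ * ((m₁₁ - m₂₂ : ℝ) + 2 * Complex.I * (m₁₂ : ℝ)) +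
        (g₁₁ - 4 * g₁₂ + 4 * Complex.I * k)) = 0 := by
      have h2σ : 2 * (σ₁ * σ₂) =
          4 * γ - 2 * ((m₁₁ - m₂₂ : ℝ) + 2 * Complex.I * (m₁₂ : ℝ)) := by
        linear_combination hσ - hsum
      have h4σ : 4 * (σ₁ ^ 2 * σ₂ ^ 2) =
          (4 * γ - 2 * ((m₁₁ - m₂₂ : ℝ) + 2 * Complex.I * (m₁₂ : ℝ))) ^ 2 := by
        rw [← h2σ]; ring
      linear_combination (4 * hprod - h4σ) / 4
    have hre := congrArg Complex.re helim
    have him := congrArg Complex.im helim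
    simp [sq] at hre him
    refine ⟨γ, by positivity, hM, hγm, by linarith, by nlinarith, hpos⟩
  · rintro ⟨γ, hγ, -, h₁₂, hk, h₁₁, -⟩
    have hg0 : 0 < g₁₂ := by
      refine lt_of_le_of_ne hg12 fun h => ?_
      rw [← h] at hpos
      nlinarith [sq_nonneg k]
    have hr0 := Real.sqrt_pos.2 hg0
    have hr2 := Real.sq_sqrt hg0.le
    have hγ2 : ((Real.sqrt γ : ℝ) : ℂ) ^ 2 = γ := by exact_mod_cast Real.sq_sqrt hγ.le
    obtain ⟨τ, hτ⟩ := IsAlgClosed.exists_pow_nat_eq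
      (((m₁₁ - m₂₂ : ℝ) : ℂ) + 2 * Complex.I * (m₁₂ : ℝ) - γ) two_pos
    -- `σ₁ + σ₂ = 2 √γ` and `σ₁² + σ₂² = 2 n` force `σ₁, σ₂ = √γ ± √(n - γ)`.
    refine ⟨Real.sqrt γ + τ, Real.sqrt γ - τ, 2 * m₁₂ + 2 * Real.sqrt g₁₂,
      2 * m₁₂ - 2 * Real.sqrt g₁₂, ⟨?_, ?_⟩, ?_, fun z => ?_, ?_⟩
    · linear_combination 2 * hγ2 + 2 * hτ
    · have h₁₂c : (g₁₂ : ℂ) = γ * m₂₂ := by exact_mod_cast h₁₂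
      have hkc : (k : ℂ) = 2 * γ * m₁₂ := by exact_mod_cast hk
      have h₁₁c : (g₁₁ : ℂ) = 4 * γ * (m₁₁ - γ) := by exact_mod_cast h₁₁
      have h2 : (Real.sqrt γ + τ) * (Real.sqrt γ - τ) =
          2 * γ - (((m₁₁ - m₂₂ : ℝ) : ℂ) + 2 * Complex.I * (m₁₂ : ℝ)) := by
        linear_combination hγ2 - hτ
      rw [← mul_pow, h2, h₁₁c, hkc, h₁₂c]
      push_cast
      ring
    · intro h
      linarith
    · have hr2c : ((Real.sqrt g₁₂ : ℝ) : ℂ) ^ 2 = g₁₂ := by exact_mod_cast hr2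
      have hfac : (z - ((2 * m₁₂ : ℝ) : ℂ)) ^ 2 - ((4 * g₁₂ : ℝ) : ℂ) =
          (z - ((2 * m₁₂ + 2 * Real.sqrt g₁₂ : ℝ) : ℂ)) *
            (z - ((2 * m₁₂ - 2 * Real.sqrt g₁₂ : ℝ) : ℂ)) := by
        push_cast
        linear_combination 4 * hr2c
      rw [← sub_eq_zero, hfac, mul_eq_zero, sub_eq_zero, sub_eq_zero]
      rfl
    · have hr2c : ((Real.sqrt g₁₂ : ℝ) : ℂ) ^ 2 = g₁₂ := by exact_mod_cast hr2
      have h₁₂c : (g₁₂ : ℂ) = γ * m₂₂ := by exact_mod_cast h₁₂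
      push_cast
      linear_combination 16 * (m₂₂ : ℂ) * hγ2 - 16 * h₁₂c - 16 * hr2c

/-! ### Rotation to a real center -/

theorem offDiag_eq (θ : ℝ) (C D : Matrix (Fin 2) (Fin 2) ℂ) :
    offDiag θ C D = (2 * Complex.I) • offHerm (Real.pi / 2) (rot θ C) (rot θ D) := by
  have h1 : Complex.exp (((Real.pi / 2 : ℝ) : ℂ) * Complex.I) = Complex.I := by
    push_cast; exact Complex.exp_pi_div_two_mul_I
  rw [offHerm_rot, offDiag, offHerm, smul_smul, Complex.ofReal_add, add_mul, neg_add,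
    Complex.exp_add, Complex.exp_add, Complex.exp_neg ((Real.pi / 2 : ℝ) * Complex.I), h1,
    Complex.inv_I, smul_add, smul_smul, smul_smul, sub_eq_add_neg, ← neg_smul]
  congr 2
  · linear_combination Complex.exp (-(θ * Complex.I)) * Complex.I_sq
  · linear_combination -Complex.exp (θ * Complex.I) * Complex.I_sq

theorem conditions_iff (θ : ℝ) (α : ℂ) (C D : Matrix (Fin 2) (Fin 2) ℂ) :
    ((IsScalarMultipleOfUnitary (offDiag θ C D) ∧ ¬ IsStarNormal (offDiag θ C D * D)) ∧
        SpreadCondition θ (blockMatrix α C D)) ↔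
      ∃ γ, PauliCondition (Complex.exp (-(θ * Complex.I)) * α) (rot θ C) (rot θ D) γ := by
  have hspread : SpreadCondition θ (blockMatrix α C D) ↔
      SpreadCondition 0 (blockMatrix (Complex.exp (-(θ * Complex.I)) * α) (rot θ C) (rot θ D)) := by
    rw [SpreadCondition, SpreadCondition, rot_zero, rot_blockMatrix]
  have hD : rot θ D = (offHerm 0 (rot θ C) (rot θ D)).conjTranspose +
      Complex.I • (offHerm (Real.pi / 2) (rot θ C) (rot θ D)).conjTranspose := by
    rw [conjTranspose_offHerm, conjTranspose_offHerm, offHerm_zero_add_I_smul]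
  have hDθ : D = Complex.exp (θ * Complex.I) • rot θ D := by
    rw [rot, smul_smul, ← Complex.exp_add]; simp
  have hunit : IsScalarMultipleOfUnitary (offDiag θ C D) ↔
      pauliDot (offHerm (Real.pi / 2) (rot θ C) (rot θ D) *
        (offHerm (Real.pi / 2) (rot θ C) (rot θ D)).conjTranspose)
        (offHerm (Real.pi / 2) (rot θ C) (rot θ D) *
          (offHerm (Real.pi / 2) (rot θ C) (rot θ D)).conjTranspose) = 0 := by
    rw [isScalarMultipleOfUnitary_iff, offDiag_eq]
    have h4 : ∀ M : Matrix (Fin 2) (Fin 2) ℂ, ((2 * Complex.I) • M) *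
        ((2 * Complex.I) • M).conjTranspose = ((4 : ℝ) : ℂ) • (M * M.conjTranspose) := by
      intro M
      rw [Matrix.conjTranspose_smul, Matrix.smul_mul, Matrix.mul_smul, smul_smul]
      congr 1
      simp
      linear_combination -4 * Complex.I_sq
    rw [h4, pauliDot_smul_smul]
    norm_num
  have hnormal : IsStarNormal (offDiag θ C D * D) ↔
      IsStarNormal (offHerm (Real.pi / 2) (rot θ C) (rot θ D) *
        ((offHerm 0 (rot θ C) (rot θ D)).conjTranspose +
          Complex.I • (offHerm (Real.pi / 2) (rot θ C) (rot θ D)).conjTranspose)) := by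
    rw [← hD, offDiag_eq]
    conv_lhs => rw [hDθ]
    have hrr : rot θ (Complex.exp (θ * Complex.I) • rot θ D) = rot θ D := by rw [← hDθ]
    rw [hrr, Matrix.smul_mul, Matrix.mul_smul, smul_smul, isStarNormal_smul_iff]
    exact mul_ne_zero (mul_ne_zero two_ne_zero Complex.I_ne_zero) (Complex.exp_ne_zero _)
  rw [hspread, hunit, hnormal]
  constructor
  · rintro ⟨⟨hM, hn⟩, hs⟩
    exact (spreadCondition_iff hM ((not_isStarNormal_iff hM).1 hn)).1 hs
  · rintro ⟨γ, h⟩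
    obtain ⟨-, hM, -, -, -, hpos⟩ := id h
    exact ⟨⟨hM, (not_isStarNormal_iff hM).2 hpos⟩, (spreadCondition_iff hM hpos).2 ⟨γ, h⟩⟩

/-- A center `c` of argument `θ` has, in the direction `φ + θ`, the coordinate `‖c‖ cos φ`. -/
theorem exists_center_iff (α : ℂ) (C D : Matrix (Fin 2) (Fin 2) ℂ) :
    (∃ (c : ℂ) (a b ψ : ℝ), c ≠ 0 ∧ 0 < a ∧ 0 < b ∧ ∀ φ,
        eigMean α C D φ = dirCoord φ c ^ 2 + halfWidthSq a b ψ φ ∧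
        eigDisc C D φ = 4 * dirCoord φ c ^ 2 * halfWidthSq a b ψ φ) ↔
      ∃ θ γ : ℝ, PauliCondition (Complex.exp (-(θ * Complex.I)) * α) (rot θ C) (rot θ D) γ := by
  have hcoord : ∀ r θ φ : ℝ, dirCoord φ (Complex.exp (θ * Complex.I) * r) =
      r * Real.cos (φ - θ) := by
    intro r θ φ
    rw [dirCoord_exp_mul]
    simp [dirCoord, mul_comm]
  simp only [exists_pauliCondition_iff, eigMean_rot, eigDisc_rot]
  constructor
  · rintro ⟨c, a, b, ψ, hc, ha, hb, h⟩
    refine ⟨c.arg, ‖c‖, a, b, ψ - c.arg, norm_pos_iff.2 hc, ha, hb, fun φ => ?_⟩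
    have h1 := h (φ + c.arg)
    have h2 := hcoord ‖c‖ c.arg (φ + c.arg)
    rw [mul_comm, Complex.norm_mul_exp_arg_mul_I, add_sub_cancel_right] at h2
    have h3 : halfWidthSq a b ψ (φ + c.arg) = halfWidthSq a b (ψ - c.arg) φ := by
      rw [halfWidthSq, halfWidthSq, show φ + c.arg - ψ = φ - (ψ - c.arg) by ring]
    rwa [h2, h3] at h1
  · rintro ⟨θ, r, a, b, ψ, hr, ha, hb, h⟩
    refine ⟨Complex.exp (θ * Complex.I) * r, a, b, ψ + θ,
      mul_ne_zero (Complex.exp_ne_zero _) (Complex.ofReal_ne_zero.2 hr.ne'), ha, hb, fun φ => ?_⟩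
    have h1 := h (φ - θ)
    have h3 : halfWidthSq a b ψ (φ - θ) = halfWidthSq a b (ψ + θ) φ := by
      rw [halfWidthSq, halfWidthSq, show φ - θ - ψ = φ - (ψ + θ) by ring]
    rwa [sub_add_cancel, h3, ← hcoord] at h1

theorem theorem5p1 (α : ℂ) (C D : Matrix (Fin 2) (Fin 2) ℂ) :
    IsBiElliptical (numericalRange (blockMatrix α C D)) ↔
      ∃ θ : ℝ,
        (IsScalarMultipleOfUnitary (offDiag θ C D) ∧ ¬ IsStarNormal (offDiag θ C D * D)) ∧
        SpreadCondition θ (blockMatrix α C D) := by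
  rw [isBiElliptical_numericalRange_iff, exists_center_iff]
  exact exists_congr fun θ => (conditions_iff θ α C D).symm
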